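/- Let $N\ge 1$, let $I_1,\dots,I_N\subset\mathbb R$ be pairwise disjoint compact intervals of positive length, $I=\bigcup_i I_i$, and let $A$ be an $N\times N$ matrix with entries in $\{0,1\}$; write $i\rightsquigarrow j$ if $A_{i,j}=1$. For each $i\rightsquigarrow j$ let $\phi_{i,j}:I_i\to\phi_{i,j}(I_i)\subset\mathrm{Int}(I_j)$ be a $C^\infty$ diffeomorphism onto its image (so $\phi_{i,j}'\neq0$ on $I_i$), such that for some $0<\theta<1$ one has $|\phi_{i,j}'(x)|\le\theta$ for all $i\rightsquigarrow j$ and $x\in I_i$, and such that $\phi_{i,j}(I_i)\cap\phi_{k,l}(I_k)\ne\emptyset$ implies $(i,j)=(k,l)$. For $B\subset I$ put $\phi(B)=\bigcup_{i\rightsquigarrow j}\phi_{i,j}(B\cap I_i)$, and let $K=\bigcap_{n\ge0}\phi^n(I)$. Let $\tau\in C^\infty(I;\mathbb R)$ and let $F$ be the multivalued map of $T^*I=I\times\mathbb R$ given by $$F(x,\xi)=\Big\{\Big(\phi_{i,j}(x),\ \tfrac{1}{\phi_{i,j}'(x)}\,\xi+\tau'(\phi_{i,j}(x))\Big)\ :\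 x\in I_i,\ i\rightsquigarrow j\Big\}.$$ For $n\ge 0$ let $F^n(\rho)$ be the set of points reached from $\rho$ by $n$ iterations of $F$, and let $F^{-n}(\rho)=\{\rho'\in T^*I:\rho\in F^n(\rho')\}$. Define the trapped set in phase space $$\mathcal K=\{\rho\in T^*I:\ \exists\, C\subset T^*I\text{ compact},\ \forall n\in\mathbb Z,\ F^n(\rho)\cap C\neq\emptyset\},$$ and for $\varepsilon>0$ let $\mathcal K_\varepsilon$ be the set of $(x,\xi)\in T^*I$ such that $\max(|x-x_0|,|\xi-\xi_0|)\le\varepsilon$ for some $(x_0,\xi_0)\in\mathcal K$. Assume minimal captivity: there is $\varepsilon>0$ such that $\sharp\big(F(\rho)\cap\mathcal K_\varepsilon\big)\le1$ for all $\rho\in\mathcal K_\varepsilon$. Assume also that $A$ is symmetric and that $K\neq\emptyset$. Then $$\dim_M\mathcal K=2\dim_M K=2\dim_H K,$$ where $\dim_H$ is the Hausdorff dimension and $\dim_M$ is the upper Minkowski dimension: for $B\subset\mathbb R^d$, $\dim_M B=d-\sup\{s\in\mathbb R:\limsup_{\delta\downarrow0}\delta^{-s}\,\mathrm{Leb}(B_\delta)<\infty\}$,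 with $B_\delta=\{x\in\mathbb R^d:\mathrm{dist}(x,B)\le\delta\}$. -/

import Mathlib

open Set Filter Topology MeasureTheory
open scoped ContDiff ENNReal Matrix

noncomputable section

/-- The upper Minkowski codimension of `B`: the supremum of the real `s` such that
`limsup_{δ ↓ 0} δ ^ (-s) * Leb (B_δ) < ∞`, where `B_δ` is the closed `δ`-neighbourhood of `B`. -/
def minkowskiCodim {E : Type*} [PseudoEMetricSpace E] [MeasureSpace E] (B : Set E) : EReal :=
  sSup ((fun s : ℝ => (s : EReal)) ''
    {s : ℝ | limsup (fun δ : ℝ => ENNReal.ofReal (δ ^ (-s)) * volume (Metric.cthickening δ B))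
      (𝓝[>] 0) < ⊤})

/-- The upper Minkowski (box) dimension `d - codim_M B` of a subset of a `d`-dimensional
Euclidean space. -/
def minkowskiDim {E : Type*} [PseudoEMetricSpace E] [MeasureSpace E] [AddCommGroup E] [Module ℝ E]
    (B : Set E) : EReal :=
  ((Module.finrank ℝ E : ℝ) : EReal) - minkowskiCodim B

/-- An iterated function scheme on `N` disjoint compact intervals `[a i, b i]`, with adjacency
matrix `A`. The map `φ i j` is only relevant when `A i j = 1`, and then only on `[a i, b i]`. -/
structure IteratedFunctionScheme (N : ℕ) where
  one_le : 1 ≤ N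
  a : Fin N → ℝ
  b : Fin N → ℝ
  a_lt_b : ∀ i, a i < b i
  disjoint_intervals : ∀ i j, i ≠ j → Disjoint (Icc (a i) (b i)) (Icc (a j) (b j))
  A : Matrix (Fin N) (Fin N) ℕ
  A_zero_or_one : ∀ i j, A i j = 0 ∨ A i j = 1
  φ : Fin N → Fin N → ℝ → ℝ
  φ_smooth : ∀ i j, A i j = 1 → ContDiffOn ℝ ∞ (φ i j) (Icc (a i) (b i))
  φ_injOn : ∀ i j, A i j = 1 → InjOn (φ i j) (Icc (a i) (b i))
  φ_deriv_ne_zero : ∀ i j, A i j = 1 → ∀ x ∈ Icc (a i) (b i),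
    derivWithin (φ i j) (Icc (a i) (b i)) x ≠ 0
  φ_maps_interior : ∀ i j, A i j = 1 → φ i j '' Icc (a i) (b i) ⊆ interior (Icc (a j) (b j))
  φ_contraction : ∃ θ : ℝ, 0 < θ ∧ θ < 1 ∧ ∀ i j, A i j = 1 → ∀ x ∈ Icc (a i) (b i),
    |derivWithin (φ i j) (Icc (a i) (b i)) x| ≤ θ
  separation : ∀ i j k l, A i j = 1 → A k l = 1 →
    (φ i j '' Icc (a i) (b i) ∩ φ k l '' Icc (a k) (b k)).Nonempty → i = k ∧ j = l

namespace IteratedFunctionScheme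

variable {N : ℕ} (S : IteratedFunctionScheme N)

/-- The interval `I_i`. -/
def interval (i : Fin N) : Set ℝ := Icc (S.a i) (S.b i)

/-- The union `I` of the intervals `I_i`. -/
def I : Set ℝ := ⋃ i, S.interval i

/-- The image of a set under the multivalued map `φ = (φ_{i,j})`. -/
def image (s : Set ℝ) : Set ℝ :=
  {y | ∃ i j, S.A i j = 1 ∧ ∃ x ∈ s ∩ S.interval i, S.φ i j x = y}

/-- `K_n = φ^n (I)`. -/
def Kn (n : ℕ) : Set ℝ := S.image^[n] S.I

/-- The trapped set `K = ⋂ K_n`. -/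
def K : Set ℝ := ⋂ n, S.Kn n

/-- The phase space `T*I = I × ℝ`. -/
def phaseSpace : Set (ℝ × ℝ) := S.I ×ˢ univ

/-- The branch `F_{i,j}(x, ξ) = (x', ξ / φ_{i,j}'(x) + τ'(x'))`, `x' = φ_{i,j}(x)`, of the
canonical map associated to the roof function `τ`. -/
def branch (τ : ℝ → ℝ) (i j : Fin N) (p : ℝ × ℝ) : ℝ × ℝ :=
  (S.φ i j p.1,
    (derivWithin (S.φ i j) (S.interval i) p.1)⁻¹ * p.2 + derivWithin τ S.I (S.φ i j p.1))

/-- The multivalued canonical map `F : T*I → T*I`. -/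
def canonicalMap (τ : ℝ → ℝ) (p : ℝ × ℝ) : Set (ℝ × ℝ) :=
  {q | ∃ i j, S.A i j = 1 ∧ p.1 ∈ S.interval i ∧ q = S.branch τ i j p}

/-- The image of a set under `F`. -/
def canonicalImage (τ : ℝ → ℝ) (s : Set (ℝ × ℝ)) : Set (ℝ × ℝ) :=
  ⋃ p ∈ s, S.canonicalMap τ p

/-- The set `F^n (p)`, for `n ∈ ℤ`; for negative `n` it consists of the points `q` with
`p ∈ F^{|n|} (q)`. -/
def canonicalPow (τ : ℝ → ℝ) : ℤ → ℝ × ℝ → Set (ℝ × ℝ)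
  | Int.ofNat n, p => (S.canonicalImage τ)^[n] {p}
  | Int.negSucc n, p => {q | p ∈ (S.canonicalImage τ)^[n + 1] {q}}

/-- The trapped set `𝒦` in phase space. -/
def phaseTrapped (τ : ℝ → ℝ) : Set (ℝ × ℝ) :=
  {p | p ∈ S.phaseSpace ∧ ∃ C : Set (ℝ × ℝ), C ⊆ S.phaseSpace ∧ IsCompact C ∧
    ∀ n : ℤ, (S.canonicalPow τ n p ∩ C).Nonempty}

/-- The `ε`-neighbourhood `𝒦_ε` of `𝒦` in `T*I`. -/
def phaseTrappedNhd (τ : ℝ → ℝ) (ε : ℝ) : Set (ℝ × ℝ) :=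
  {p | p ∈ S.phaseSpace ∧ ∃ p₀ ∈ S.phaseTrapped τ, max |p.1 - p₀.1| |p.2 - p₀.2| ≤ ε}

/-- Minimal captivity. -/
def MinimallyCaptive (τ : ℝ → ℝ) : Prop :=
  ∃ ε : ℝ, 0 < ε ∧ ∀ p ∈ S.phaseTrappedNhd τ ε,
    (S.canonicalMap τ p ∩ S.phaseTrappedNhd τ ε).encard ≤ 1

/-- The trapped set `𝒦` as a subset of the Euclidean plane. -/
def phaseTrappedPlane (τ : ℝ → ℝ) : Set (EuclideanSpace ℝ (Fin 2)) :=
  (fun p : ℝ × ℝ => !₂[p.1, p.2]) '' S.phaseTrapped τ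

end IteratedFunctionScheme

end

/-!
Count the paths of the graph by the contraction of the maps `φ` along them. Suppose that at some
vertex there are `r ^ (-t)` loops of equal length which contract at most by the factor `r`. Their
free products yield `r ^ (-t * m)` loops which contract at most by `r ^ m`, so that `K` contains
the limit set of these loops, of dimension at least `t`. A point of `𝒦` is given by a past, which
determines `x`, and a future, which determines `ξ`; by minimal captivity different futures lead to
well separated `ξ`, and pairs of loops give `r ^ (-2 * t * m)` points of `𝒦` at mutual distances
of order `r ^ m`.

Suppose that there are no such loops. In a symmetric graph every path can be closed up to a loop
by one of finitely many return paths. Hence `O(δ ^ (-t))` paths of each given length contract at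
most by `δ`, and only `O(log (1 / δ))` lengths occur. Those contracting by about `δ` cover `K` by
sets of diameter `O(δ)`, and pairs of them, one for the past and one for the future, cover `𝒦`.
-/

open scoped NNReal

section BoxCounting

variable {X E : Type*} [MetricSpace X]

/-- `B` is covered by `O(δ ^ (-t))` balls of radius `O(δ)` as `δ ↓ 0`: an upper bound for the box
counting function at all small scales. -/
def CoverBound (B : Set X) (t : ℝ) : Prop :=
  ∃ C c : ℝ, 0 ≤ c ∧ ∀ᶠ δ : ℝ in 𝓝[>] 0, ∃ P : Finset X,
    (P.card : ℝ) ≤ C * δ ^ (-t) ∧ B ⊆ ⋃ p ∈ P, Metric.closedBall p (c * δ)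

/-- For arbitrarily small `δ`, the set `B` contains at least `c * δ ^ (-t)` points at mutual
distances at least `2 * δ`: a lower bound for the box counting function along some scales. -/
def PackingBound (B : Set X) (t : ℝ) : Prop :=
  ∃ c : ℝ, 0 < c ∧ ∃ᶠ δ : ℝ in 𝓝[>] 0, ∃ P : Finset X, ↑P ⊆ B ∧
    (P : Set X).Pairwise (fun x y => 2 * δ ≤ dist x y) ∧ c * δ ^ (-t) ≤ P.card

theorem CoverBound.hausdorffMeasure_ne_top [MeasurableSpace X] [BorelSpace X] {B : Set X} {t : ℝ}
    (ht : 0 ≤ t) (h : CoverBound B t) : μH[t] B ≠ ⊤ := by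
  obtain ⟨C, c, hc, h⟩ := h
  obtain ⟨P, hP⟩ := h.choice
  have hediam (δ : ℝ) (p : X) :
      Metric.ediam (Metric.closedBall p (c * δ)) ≤ ENNReal.ofReal (2 * (c * δ)) :=
    Metric.ediam_le fun x hx y hy => by
      rw [edist_dist]
      refine ENNReal.ofReal_le_ofReal ?_
      linarith [dist_triangle_right x y p, Metric.mem_closedBall.1 hx, Metric.mem_closedBall.1 hy]
  have hradius : Tendsto (fun δ : ℝ => ENNReal.ofReal (2 * (c * δ))) (𝓝[>] 0) (𝓝 0) := by
    refine ((ENNReal.continuous_ofReal.comp (by fun_prop)).tendsto' 0 0 ?_).mono_left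
      nhdsWithin_le_nhds
    simp only [Function.comp_apply, mul_zero, ENNReal.ofReal_zero]
  refine ((Measure.hausdorffMeasure_le_liminf_sum t B _ hradius
    (fun δ (p : P δ) => Metric.closedBall p.1 (c * δ)) (.of_forall fun δ p => hediam δ p)
    (hP.mono fun δ hδ => hδ.2.trans (iUnion₂_subset fun p hp =>
      subset_iUnion_of_subset ⟨p, hp⟩ subset_rfl))).trans
      (liminf_le_of_frequently_le' (Eventually.frequently ?_))).trans_lt
        (ENNReal.ofReal_lt_top (r := C * (2 * c) ^ t)) |>.ne
  filter_upwards [hP, self_mem_nhdsWithin] with δ hPδ (hδ : 0 < δ)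
  calc ∑ p : P δ, Metric.ediam (Metric.closedBall p.1 (c * δ)) ^ t
      ≤ ∑ _p : P δ, ENNReal.ofReal (2 * (c * δ)) ^ t := by gcongr with p; exact hediam δ p
    _ = ENNReal.ofReal ((P δ).card * (2 * (c * δ)) ^ t) := by
        rw [Finset.sum_const, nsmul_eq_mul, ENNReal.ofReal_rpow_of_nonneg (by positivity) ht,
          ENNReal.ofReal_mul (Nat.cast_nonneg _), ENNReal.ofReal_natCast, Finset.card_univ,
          Fintype.card_coe]
    _ ≤ ENNReal.ofReal (C * δ ^ (-t) * (2 * (c * δ)) ^ t) := by gcongr; exact hPδ.1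
    _ = ENNReal.ofReal (C * (2 * c) ^ t) := by
        rw [← mul_assoc 2, Real.mul_rpow (by positivity) hδ.le, Real.rpow_neg hδ.le]
        congr 1
        field_simp

theorem CoverBound.dimH_le {B : Set X} {t : ℝ} (ht : 0 ≤ t) (h : CoverBound B t) :
    dimH B ≤ ENNReal.ofReal t := by
  borelize X
  refine dimH_le_of_hausdorffMeasure_ne_top ?_
  rw [Real.coe_toNNReal t ht]
  exact h.hausdorffMeasure_ne_top ht

theorem le_minkowskiCodim_of_eventually_le [PseudoEMetricSpace E] [MeasureSpace E] {B : Set E}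
    {C s : ℝ}
    (h : ∀ᶠ δ in 𝓝[>] 0, volume (Metric.cthickening δ B) ≤ ENNReal.ofReal (C * δ ^ s)) :
    s ≤ minkowskiCodim B := by
  refine le_sSup ⟨s, (limsup_le_of_le (a := ENNReal.ofReal C) ?_ ?_).trans_lt
    ENNReal.ofReal_lt_top, rfl⟩
  · isBoundedDefault
  filter_upwards [h, self_mem_nhdsWithin] with δ hδB (hδ : 0 < δ)
  calc ENNReal.ofReal (δ ^ (-s)) * volume (Metric.cthickening δ B)
      ≤ ENNReal.ofReal (δ ^ (-s)) * ENNReal.ofReal (C * δ ^ s) := by gcongr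
    _ = ENNReal.ofReal C := by
        rw [← ENNReal.ofReal_mul (by positivity), mul_left_comm, ← Real.rpow_add hδ, neg_add_cancel,
          Real.rpow_zero, mul_one]

theorem minkowskiCodim_le_of_frequently_le [PseudoEMetricSpace E] [MeasureSpace E] {B : Set E}
    {c s : ℝ} (hc : 0 < c)
    (h : ∃ᶠ δ in 𝓝[>] 0, ENNReal.ofReal (c * δ ^ s) ≤ volume (Metric.cthickening δ B)) :
    minkowskiCodim B ≤ s := by
  refine sSup_le ?_
  rintro _ ⟨s', hs', rfl⟩
  by_contra! hlt
  obtain ⟨M, hM, hMtop⟩ := exists_between (mem_ofPred.1 hs')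
  have htop : Tendsto (fun δ : ℝ => ENNReal.ofReal (c * δ ^ (-(s' - s)))) (𝓝[>] 0) (𝓝 ⊤) :=
    ENNReal.tendsto_ofReal_nhds_top.2 <| (tendsto_rpow_neg_nhdsGT_zero
      (neg_lt_zero.2 (sub_pos.2 (EReal.coe_lt_coe_iff.1 hlt)))).const_mul_atTop hc
  obtain ⟨δ, hδB, hlow, hhigh, hδ : 0 < δ⟩ := (h.and_eventually ((htop.eventually
    (lt_mem_nhds hMtop)).and ((eventually_lt_of_limsup_lt hM).and self_mem_nhdsWithin))).exists
  refine absurd hhigh (hlow.trans_le ?_).not_gt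
  calc ENNReal.ofReal (c * δ ^ (-(s' - s)))
      = ENNReal.ofReal (δ ^ (-s')) * ENNReal.ofReal (c * δ ^ s) := by
        rw [← ENNReal.ofReal_mul (by positivity), mul_left_comm, ← Real.rpow_add hδ]
        ring_nf
    _ ≤ _ := by gcongr

theorem PackingBound.of_forall_pow {ι : Type*} {B : Set X} {t c r : ℝ} (hc : 0 < c) (hr : 0 < r)
    (hr1 : r < 1) (h : ∀ m : ℕ, ∃ (s : Finset ι) (f : ι → X), MapsTo f s B ∧
      (s : Set ι).Pairwise (fun a b => c * r ^ m ≤ dist (f a) (f b)) ∧ (r ^ m) ^ (-t) ≤ s.card) :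
    PackingBound B t := by
  classical
  have hscale : Tendsto (fun m : ℕ => c / 2 * r ^ m) atTop (𝓝[>] 0) := by
    refine tendsto_nhdsWithin_iff.2
      ⟨?_, .of_forall fun m => mem_Ioi.2 (mul_pos (half_pos hc) (pow_pos hr m))⟩
    simpa only [mul_zero] using (tendsto_pow_atTop_nhds_zero_of_lt_one hr.le hr1).const_mul (c / 2)
  refine ⟨(c / 2) ^ t, by positivity, hscale.frequently (.of_forall fun m => ?_)⟩
  obtain ⟨s, f, hfB, hsep, hcard⟩ := h m
  have hinj : InjOn f s := fun a ha b hb hab => by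
    by_contra hne
    have : c * r ^ m ≤ dist (f a) (f b) := hsep ha hb hne
    rw [hab, dist_self] at this
    exact this.not_gt (by positivity)
  refine ⟨s.image f, by simpa only [Finset.coe_image] using hfB.image_subset, ?_, ?_⟩
  · rw [Finset.coe_image, hinj.pairwise_image]
    refine hsep.imp fun a b hab => ?_
    simp only [Function.onFun]
    linarith
  · rw [Finset.card_image_of_injOn hinj, Real.mul_rpow (by positivity) (by positivity),
      ← mul_assoc, ← Real.rpow_add (by positivity), add_neg_cancel, Real.rpow_zero, one_mul]
    exact hcard

variable [NormedAddCommGroup E] [NormedSpace ℝ E] [MeasureSpace E] [BorelSpace E]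
  [FiniteDimensional ℝ E] [(volume : Measure E).IsAddHaarMeasure]

theorem volume_cthickening_le_of_subset_iUnion_closedBall {B : Set E} {P : Finset E} {r δ : ℝ}
    (hr : 0 ≤ r) (hδ : 0 < δ) (hB : B ⊆ ⋃ p ∈ P, Metric.closedBall p r) :
    volume (Metric.cthickening δ B) ≤ ENNReal.ofReal (P.card *
      ((r + 2 * δ) ^ Module.finrank ℝ E * volume.real (Metric.closedBall (0 : E) 1))) := by
  have hsub : Metric.cthickening δ B ⊆ ⋃ p ∈ P, Metric.closedBall p (r + 2 * δ) := fun x hx => by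
    obtain ⟨y, hy, hxy⟩ := mem_iUnion₂.1
      (Metric.cthickening_subset_iUnion_closedBall_of_lt B (by positivity) (by linarith) hx :
        x ∈ ⋃ y ∈ B, Metric.closedBall y (2 * δ))
    obtain ⟨p, hp, hyp⟩ := mem_iUnion₂.1 (hB hy)
    refine mem_iUnion₂.2 ⟨p, hp, Metric.mem_closedBall.2 ?_⟩
    linarith [dist_triangle x y p, Metric.mem_closedBall.1 hxy, Metric.mem_closedBall.1 hyp]
  refine (measure_mono hsub).trans ((measure_biUnion_finset_le P _).trans_eq ?_)
  rw [ENNReal.ofReal_mul (Nat.cast_nonneg _), ENNReal.ofReal_natCast, ← nsmul_eq_mul]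
  refine Finset.sum_eq_card_nsmul fun p _ => ?_
  rw [← Measure.addHaar_real_closedBall' volume p (by positivity), ofReal_measureReal
    measure_closedBall_lt_top.ne]

theorem le_volume_cthickening_of_pairwise_le_dist {B : Set E} {P : Finset E} {δ : ℝ} (hδ : 0 < δ)
    (hPB : ↑P ⊆ B) (hP : (P : Set E).Pairwise fun x y => 2 * δ ≤ dist x y) :
    ENNReal.ofReal
      (P.card * (δ ^ Module.finrank ℝ E * volume.real (Metric.ball (0 : E) 1))) ≤
        volume (Metric.cthickening δ B) := by
  have hsub : ⋃ p ∈ P, Metric.ball p δ ⊆ Metric.cthickening δ B := iUnion₂_subset fun p hp =>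
    (Metric.ball_subset_thickening (hPB hp) _).trans (Metric.thickening_subset_cthickening _ _)
  have hdisj : (P : Set E).PairwiseDisjoint fun p => Metric.ball p δ := fun x hx y hy hxy =>
    Metric.ball_disjoint_ball (by linarith [hP hx hy hxy])
  refine le_of_eq_of_le ?_ (measure_mono hsub)
  rw [measure_biUnion_finset hdisj fun p _ => Metric.isOpen_ball.measurableSet,
    ENNReal.ofReal_mul (Nat.cast_nonneg _), ENNReal.ofReal_natCast, ← nsmul_eq_mul]
  refine (Finset.sum_eq_card_nsmul fun p _ => ?_).symm
  rw [Measure.addHaar_ball_of_pos volume p hδ, ENNReal.ofReal_mul (by positivity),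
    ofReal_measureReal measure_ball_lt_top.ne]

theorem CoverBound.minkowskiDim_le {B : Set E} {t : ℝ} (h : CoverBound B t) :
    minkowskiDim B ≤ t := by
  obtain ⟨C, c, hc, h⟩ := h
  set d := Module.finrank ℝ E
  set v := volume.real (Metric.closedBall (0 : E) 1)
  have hcodim : ((d - t : ℝ) : EReal) ≤ minkowskiCodim B := by
    refine le_minkowskiCodim_of_eventually_le (C := C * ((c + 2) ^ d * v)) ?_
    filter_upwards [h, self_mem_nhdsWithin] with δ ⟨P, hcard, hcov⟩ (hδ : 0 < δ)
    refine (volume_cthickening_le_of_subset_iUnion_closedBall (by positivity) hδ hcov).trans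
      (ENNReal.ofReal_le_ofReal ?_)
    calc P.card * ((c * δ + 2 * δ) ^ d * v)
        ≤ C * δ ^ (-t) * ((c * δ + 2 * δ) ^ d * v) := by gcongr
      _ = C * ((c + 2) ^ d * v) * δ ^ (d - t) := by
          rw [sub_eq_neg_add, Real.rpow_add_natCast hδ.ne', ← add_mul, mul_pow]
          ring
  calc minkowskiDim B ≤ (d : ℝ) - ((d - t : ℝ) : EReal) := EReal.sub_le_sub le_rfl hcodim
    _ = t := by rw [← EReal.coe_sub, sub_sub_cancel]

theorem PackingBound.le_minkowskiDim {B : Set E} {t : ℝ} (h : PackingBound B t) :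
    t ≤ minkowskiDim B := by
  obtain ⟨c, hc, h⟩ := h
  set d := Module.finrank ℝ E
  set v := volume.real (Metric.ball (0 : E) 1)
  have hv : 0 < v :=
    ENNReal.toReal_pos (Metric.measure_ball_pos _ _ one_pos).ne' measure_ball_lt_top.ne
  have hcodim : minkowskiCodim B ≤ ((d - t : ℝ) : EReal) := by
    refine minkowskiCodim_le_of_frequently_le (mul_pos hc hv) ?_
    refine (h.and_eventually self_mem_nhdsWithin).mono ?_
    rintro δ ⟨⟨P, hPB, hP, hcard⟩, hδ : 0 < δ⟩
    refine (ENNReal.ofReal_le_ofReal ?_).trans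
      (le_volume_cthickening_of_pairwise_le_dist hδ hPB hP)
    calc c * v * δ ^ (d - t) = c * δ ^ (-t) * (δ ^ d * v) := by
          rw [sub_eq_neg_add, Real.rpow_add_natCast hδ.ne']
          ring
      _ ≤ P.card * (δ ^ d * v) := by gcongr
  calc (t : EReal) = (d : ℝ) - ((d - t : ℝ) : EReal) := by rw [← EReal.coe_sub, sub_sub_cancel]
    _ ≤ minkowskiDim B := EReal.sub_le_sub le_rfl hcodim

theorem minkowskiDim_eq_of_forall_packingBound_of_forall_coverBound {B : Set E} {d : ℝ}
    (hpack : ∀ t < d, PackingBound B t) (hcover : ∀ t > d, CoverBound B t) :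
    minkowskiDim B = d :=
  le_antisymm
    (EReal.le_of_forall_lt_iff_le.1 fun t ht =>
      (hcover t (EReal.coe_lt_coe_iff.1 ht)).minkowskiDim_le)
    (EReal.ge_of_forall_gt_iff_ge.1 fun t ht =>
      (hpack t (EReal.coe_lt_coe_iff.1 ht)).le_minkowskiDim)

end BoxCounting

section Plane

theorem max_abs_sub_le_dist_plane (a b c d : ℝ) :
    max |a - c| |b - d| ≤ dist (!₂[a, b] : EuclideanSpace ℝ (Fin 2)) !₂[c, d] :=
  max_le (PiLp.dist_apply_le !₂[a, b] !₂[c, d] 0) (PiLp.dist_apply_le !₂[a, b] !₂[c, d] 1)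

theorem dist_plane_le (a b c d : ℝ) :
    dist (!₂[a, b] : EuclideanSpace ℝ (Fin 2)) !₂[c, d] ≤ |a - c| + |b - d| := by
  rw [EuclideanSpace.dist_eq, Fin.sum_univ_two]
  refine Real.sqrt_le_iff.2 ⟨by positivity, ?_⟩
  have : 0 ≤ |a - c| * |b - d| := by positivity
  simp only [Matrix.cons_val_zero, Matrix.cons_val_one, Real.dist_eq]
  linarith [add_sq |a - c| |b - d|]

end Plane

section MetricLemmas

variable {ι P X : Type*}

theorem exists_pos_le_dist_of_pairwise_disjoint_isCompact [Finite ι] [MetricSpace X] {s : ι → Set X}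
    (hs : ∀ i, IsCompact (s i)) (hdisj : Pairwise (Function.onFun Disjoint s)) :
    ∃ g > 0, ∀ i j, i ≠ j → ∀ x ∈ s i, ∀ y ∈ s j, g ≤ dist x y := by
  have hpair (i j : ι) : ∀ᶠ g : ℝ in 𝓝[>] 0, i ≠ j → ∀ x ∈ s i, ∀ y ∈ s j, g ≤ dist x y := by
    rcases eq_or_ne i j with rfl | hij
    · exact .of_forall fun g hne => (hne rfl).elim
    obtain ⟨r, hr, hrdist⟩ :=
      Metric.exists_pos_forall_lt_edist (hs i) (hs j).isClosed (hdisj hij)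
    filter_upwards [Ioo_mem_nhdsGT (NNReal.coe_pos.2 hr)] with g hg _ x hx y hy
    have hxy : r ≤ nndist x y := by exact_mod_cast (edist_nndist x y ▸ (hrdist x hx y hy).le)
    exact hg.2.le.trans (NNReal.coe_le_coe.2 hxy)
  obtain ⟨g, hg, hpos⟩ := ((eventually_all.2 fun i => eventually_all.2 (hpair i)).and
    self_mem_nhdsWithin).exists
  exact ⟨g, hpos, hg⟩

theorem exists_forall_eq_apply_of_lipschitzWith [MetricSpace X] [CompleteSpace X] [BoundedSpace X]
    [Nonempty X] {K : ℝ≥0} (hK : K < 1) (T : P → P) {f : P → X → X}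
    (hf : ∀ p, LipschitzWith K (f p)) : ∃ ζ : P → X, ∀ p, ζ p = f p (ζ (T p)) := by
  let _ : TopologicalSpace P := ⊥
  have : DiscreteTopology P := ⟨rfl⟩
  obtain ⟨C, hC⟩ := Metric.isBounded_iff.1 (Bornology.IsBounded.all (univ : Set X))
  have : Nonempty (BoundedContinuousFunction P X) := ⟨.const P (Classical.arbitrary X)⟩
  let Φ (ζ : BoundedContinuousFunction P X) : BoundedContinuousFunction P X :=
    .mkOfDiscrete (fun p => f p (ζ (T p))) C fun _ _ => hC (mem_univ _) (mem_univ _)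
  have hΦ : ContractingWith K Φ := ⟨hK, .of_dist_le_mul fun ζ ζ' =>
    (BoundedContinuousFunction.dist_le (by positivity)).2 fun p =>
      ((hf p).dist_le_mul _ _).trans (by gcongr; exact ζ.dist_coe_le_dist _)⟩
  exact ⟨hΦ.fixedPoint, fun p => congrArg (· p) hΦ.fixedPoint_isFixedPt.symm⟩

theorem exists_sub_eq_mul_sub_of_hasDerivWithinAt {s : Set ℝ} (hs : s.OrdConnected) {f f' : ℝ → ℝ}
    (hf : ∀ x ∈ s, HasDerivWithinAt f (f' x) s x) {x y : ℝ} (hx : x ∈ s) (hy : y ∈ s) :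
    ∃ z ∈ s, f x - f y = f' z * (x - y) := by
  wlog hxy : y < x generalizing x y
  · rcases (not_lt.1 hxy).eq_or_lt with rfl | hlt
    · exact ⟨x, hx, by ring⟩
    · obtain ⟨z, hz, h⟩ := this hy hx hlt
      exact ⟨z, hz, by linear_combination -h⟩
  have hsub : Icc y x ⊆ s := hs.out hy hx
  obtain ⟨z, hz, h⟩ := exists_hasDerivAt_eq_slope f f' hxy
    (fun w hw => ((hf w (hsub hw)).mono hsub).continuousWithinAt)
    fun w hw => (hf w (hsub (Ioo_subset_Icc_self hw))).hasDerivAt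
      (mem_of_superset (Icc_mem_nhds hw.1 hw.2) hsub)
  exact ⟨z, hsub (Ioo_subset_Icc_self hz), by rw [h, div_mul_cancel₀ _ (sub_pos.2 hxy).ne']⟩

end MetricLemmas

section Coding

variable {ι X : Type*} [MetricSpace X] {c r : ℝ}

theorem le_dist_coding {f : ι → X → X} {π : (ℕ → ι) → X}
    (hπ : ∀ u, π u = f (u 0) (π fun k => u (k + 1))) (hr : 0 ≤ r)
    (hexp : ∀ a x y, r * dist x y ≤ dist (f a x) (f a y))
    (hsep : ∀ a b, a ≠ b → ∀ x y, c ≤ dist (f a x) (f b y)) {u v : ℕ → ι} {k : ℕ}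
    (hlt : ∀ j < k, u j = v j) (hk : u k ≠ v k) : c * r ^ k ≤ dist (π u) (π v) := by
  induction k generalizing u v with
  | zero =>
    rw [pow_zero, mul_one, hπ u, hπ v]
    exact hsep _ _ hk _ _
  | succ k ih =>
    rw [hπ u, hπ v, hlt 0 k.succ_pos]
    refine le_trans ?_ (hexp _ _ _)
    rw [pow_succ', mul_left_comm]
    gcongr
    exact ih (fun j hj => hlt _ (Nat.succ_lt_succ hj)) hk

theorem abs_ofDigits_sub_le_mul_dist_rpow {M : ℕ} {π : (ℕ → Fin M) → X} {t : ℝ} (hc : 0 < c)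
    (hr : 0 < r) (ht : 0 ≤ t) (hM : r ^ (-t) ≤ M)
    (hπ : ∀ u v k, (∀ j < k, u j = v j) → u k ≠ v k → c * r ^ k ≤ dist (π u) (π v))
    (u v : ℕ → Fin M) :
    |Real.ofDigits u - Real.ofDigits v| ≤ c ^ (-t) * dist (π u) (π v) ^ t := by
  rcases eq_or_ne u v with rfl | huv
  · rw [sub_self, abs_zero]
    positivity
  have hlt : ∀ j < PiNat.firstDiff u v, u j = v j := fun _ => PiNat.apply_eq_of_lt_firstDiff
  have hdist := hπ u v _ hlt (PiNat.apply_firstDiff_ne huv)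
  set k := PiNat.firstDiff u v
  calc |Real.ofDigits u - Real.ofDigits v|
      ≤ ((M : ℝ) ^ k)⁻¹ := Real.abs_ofDigits_sub_ofDigits_le hlt
    _ ≤ ((r ^ (-t)) ^ k)⁻¹ := by gcongr
    _ = c ^ (-t) * (c * r ^ k) ^ t := by
        rw [Real.mul_rpow hc.le (by positivity), ← mul_assoc, ← Real.rpow_add hc, neg_add_cancel,
          Real.rpow_zero, one_mul, Real.rpow_neg hr.le, inv_pow, inv_inv, Real.rpow_pow_comm hr.le]
    _ ≤ _ := by gcongr

theorem le_dimH_range_of_coding_separated [Fintype ι] {π : (ℕ → ι) → X} {t : ℝ} (hc : 0 < c)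
    (hr : 0 < r) (hr1 : r < 1) (ht : 0 < t) (hcard : r ^ (-t) ≤ Fintype.card ι)
    (hπ : ∀ u v k, (∀ j < k, u j = v j) → u k ≠ v k → c * r ^ k ≤ dist (π u) (π v)) :
    ENNReal.ofReal t ≤ dimH (range π) := by
  set M := Fintype.card ι
  let π' (u : ℕ → Fin M) : X := π fun k => (Fintype.equivFin ι).symm (u k)
  have hbound := abs_ofDigits_sub_le_mul_dist_rpow (π := π') hc hr ht.le hcard fun u v k hlt hk =>
    hπ _ _ k (fun j hj => congrArg _ (hlt j hj)) ((Fintype.equivFin ι).symm.injective.ne hk)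
  have hM1 : 1 < M := by
    exact_mod_cast (Real.one_lt_rpow_of_pos_of_lt_one_of_neg hr hr1 (neg_lt_zero.2 ht)).trans_le
      hcard
  have : NeZero M := ⟨by omega⟩
  let G (y : X) : ℝ := Real.ofDigits (Function.invFun π' y)
  have hG (u : ℕ → Fin M) : G (π' u) = Real.ofDigits u := by
    have hinv : π' (Function.invFun π' (π' u)) = π' u := Function.invFun_eq ⟨u, rfl⟩
    have := hbound (Function.invFun π' (π' u)) u
    rw [hinv, dist_self, Real.zero_rpow ht.ne', mul_zero] at this
    exact sub_eq_zero.1 (abs_eq_zero.1 (le_antisymm this (abs_nonneg _)))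
  have hholder : HolderOnWith (c ^ (-t)).toNNReal t.toNNReal G (range π') := by
    rintro _ ⟨u, rfl⟩ _ ⟨v, rfl⟩
    rw [hG, hG, edist_dist, edist_dist, Real.coe_toNNReal t ht.le,
      ENNReal.ofReal_rpow_of_nonneg dist_nonneg ht.le, ← ENNReal.ofReal.eq_1,
      ← ENNReal.ofReal_mul (by positivity)]
    exact ENNReal.ofReal_le_ofReal (hbound u v)
  have hIco : Ico (0 : ℝ) 1 ⊆ G '' range π' := fun y hy =>
    ⟨π' (Real.digits y M), ⟨_, rfl⟩, (hG _).trans (Real.ofDigits_digits hM1 hy)⟩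
  have hdim : (1 : ℝ≥0∞) ≤ dimH (range π') / ENNReal.ofReal t := calc
    (1 : ℝ≥0∞) = dimH (Ico (0 : ℝ) 1) := by
      rw [Real.dimH_of_nonempty_interior (by simp), Module.finrank_self, Nat.cast_one]
    _ ≤ dimH (G '' range π') := dimH_mono hIco
    _ ≤ _ := hholder.dimH_image_le (Real.toNNReal_pos.2 ht)
  rw [ENNReal.le_div_iff_mul_le (.inl (by simpa using ht)) (.inl ENNReal.ofReal_ne_top),
    one_mul] at hdim
  exact hdim.trans (dimH_mono (range_comp_subset_range _ π))

end Coding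

namespace IteratedFunctionScheme

variable {N : ℕ} (S : IteratedFunctionScheme N)

/-- The derivative of `φ i j` on the interval `I_i`. -/
noncomputable def dφ (i j : Fin N) (x : ℝ) : ℝ := derivWithin (S.φ i j) (S.interval i) x

/-- A uniform contraction rate of the maps `φ i j`. -/
noncomputable def θ : ℝ := S.φ_contraction.choose

/-- The list `l` continues the vertex `i` to a path in the directed graph with adjacency
matrix `A`. -/
def IsPath : Fin N → List (Fin N) → Prop
  | _, [] => True
  | i, j :: l => S.A i j = 1 ∧ IsPath j l

/-- The last vertex of the path `i :: l`. -/
def endpoint : Fin N → List (Fin N) → Fin N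
  | i, [] => i
  | _, j :: l => endpoint j l

/-- The composition of the maps `φ` along the path `i :: l`. -/
def wordMap : Fin N → List (Fin N) → ℝ → ℝ
  | _, [], x => x
  | i, j :: l, x => wordMap j l (S.φ i j x)

/-- The derivative of `wordMap i l` on the interval `I_i`, as given by the chain rule. -/
noncomputable def wordDeriv : Fin N → List (Fin N) → ℝ → ℝ
  | _, [], _ => 1
  | i, j :: l, x => S.dφ i j x * wordDeriv j l (S.φ i j x)

/-- The fibre coordinate `ξ` of the point over `x` which the canonical map moves to
`(wordMap i l x, η)` along the path `i :: l`. -/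
noncomputable def pull (τ : ℝ → ℝ) : Fin N → List (Fin N) → ℝ → ℝ → ℝ
  | _, [], _, η => η
  | i, j :: l, x, η => S.dφ i j x * (pull τ j l (S.φ i j x) η - derivWithin τ S.I (S.φ i j x))

variable {S} {τ : ℝ → ℝ} {i i' j : Fin N} {l l' : List (Fin N)} {x y : ℝ}

theorem θ_pos : 0 < S.θ := S.φ_contraction.choose_spec.1

theorem θ_lt_one : S.θ < 1 := S.φ_contraction.choose_spec.2.1

theorem abs_dφ_le (h : S.A i j = 1) (hx : x ∈ S.interval i) : |S.dφ i j x| ≤ S.θ :=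
  S.φ_contraction.choose_spec.2.2 i j h x hx

theorem dφ_ne_zero (h : S.A i j = 1) (hx : x ∈ S.interval i) : S.dφ i j x ≠ 0 :=
  S.φ_deriv_ne_zero i j h x hx

theorem interval_subset_I (i : Fin N) : S.interval i ⊆ S.I := subset_iUnion _ i

theorem isCompact_interval (i : Fin N) : IsCompact (S.interval i) := isCompact_Icc

theorem isCompact_I : IsCompact S.I := isCompact_iUnion isCompact_interval

theorem left_mem_interval (i : Fin N) : S.a i ∈ S.interval i := left_mem_Icc.2 (S.a_lt_b i).le

theorem uniqueDiffOn_interval (i : Fin N) : UniqueDiffOn ℝ (S.interval i) :=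
  uniqueDiffOn_Icc (S.a_lt_b i)

theorem eq_of_mem_interval (hi : x ∈ S.interval i) (hj : x ∈ S.interval j) : i = j := by
  by_contra h
  exact (S.disjoint_intervals i j h).notMem_of_mem_left hi hj

theorem φ_mem_interval (h : S.A i j = 1) (hx : x ∈ S.interval i) : S.φ i j x ∈ S.interval j :=
  interior_subset (S.φ_maps_interior i j h (mem_image_of_mem _ hx))

theorem hasDerivWithinAt_φ (h : S.A i j = 1) (hx : x ∈ S.interval i) :
    HasDerivWithinAt (S.φ i j) (S.dφ i j x) (S.interval i) x :=
  ((S.φ_smooth i j h).differentiableOn (by simp) x hx).hasDerivWithinAt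

theorem contDiffOn_dφ (h : S.A i j = 1) : ContDiffOn ℝ 1 (S.dφ i j) (S.interval i) :=
  (S.φ_smooth i j h).derivWithin (uniqueDiffOn_interval i) (by norm_cast)

theorem I_eventuallyEq_interval (hx : x ∈ S.interval i) : S.I =ᶠ[𝓝 x] S.interval i := by
  have hclosed : IsClosed (⋃ j ∈ ({i}ᶜ : Set (Fin N)), S.interval j) :=
    (toFinite _).isClosed_biUnion fun j _ => (isCompact_interval j).isClosed
  have hnot : x ∈ (⋃ j ∈ ({i}ᶜ : Set (Fin N)), S.interval j)ᶜ := by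
    simp only [mem_compl_iff, mem_iUnion, not_exists]
    exact fun j hj hxj => hj (eq_of_mem_interval hxj hx)
  filter_upwards [hclosed.isOpen_compl.mem_nhds hnot] with y hy
  refine propext ⟨fun h => ?_, fun h => interval_subset_I i h⟩
  obtain ⟨j, hj⟩ := mem_iUnion.1 h
  by_cases hji : j = i
  · exact hji ▸ hj
  · exact (hy (mem_iUnion₂.2 ⟨j, hji, hj⟩)).elim

theorem contDiffOn_derivWithin_I (hτ : ContDiffOn ℝ 2 τ S.I) (i : Fin N) :
    ContDiffOn ℝ 1 (derivWithin τ S.I) (S.interval i) :=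
  ((hτ.mono (interval_subset_I i)).derivWithin (uniqueDiffOn_interval i) (by norm_num)).congr
    fun _ hx => derivWithin_congr_set (I_eventuallyEq_interval hx)

/-! ### Paths -/

theorem endpoint_append (i : Fin N) (l l' : List (Fin N)) :
    endpoint i (l ++ l') = endpoint (endpoint i l) l' := by
  induction l generalizing i with
  | nil => rfl
  | cons j _ ih => exact ih j

theorem isPath_append : S.IsPath i (l ++ l') ↔ S.IsPath i l ∧ S.IsPath (endpoint i l) l' := by
  induction l generalizing i with
  | nil => simp only [List.nil_append, IsPath, endpoint, true_and]
  | cons j l ih => simp only [List.cons_append, IsPath, endpoint, ih, and_assoc]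

theorem wordMap_append (i : Fin N) (l l' : List (Fin N)) (x : ℝ) :
    S.wordMap i (l ++ l') x = S.wordMap (endpoint i l) l' (S.wordMap i l x) := by
  induction l generalizing i x with
  | nil => rfl
  | cons j _ ih => exact ih j _

theorem wordDeriv_append (i : Fin N) (l l' : List (Fin N)) (x : ℝ) :
    S.wordDeriv i (l ++ l') x =
      S.wordDeriv i l x * S.wordDeriv (endpoint i l) l' (S.wordMap i l x) := by
  induction l generalizing i x with
  | nil => simp only [List.nil_append, wordDeriv, wordMap, endpoint, one_mul]
  | cons j l ih => simp only [List.cons_append, wordDeriv, wordMap, endpoint, ih, mul_assoc]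

theorem pull_append (τ : ℝ → ℝ) (i : Fin N) (l l' : List (Fin N)) (x η : ℝ) :
    S.pull τ i (l ++ l') x η = S.pull τ i l x (S.pull τ (endpoint i l) l' (S.wordMap i l x) η) := by
  induction l generalizing i x with
  | nil => rfl
  | cons j l ih => simp only [List.cons_append, pull, wordMap, endpoint, ih]

theorem pull_sub_pull (τ : ℝ → ℝ) (i : Fin N) (l : List (Fin N)) (x η η' : ℝ) :
    S.pull τ i l x η - S.pull τ i l x η' = S.wordDeriv i l x * (η - η') := by
  induction l generalizing i x with
  | nil => simp only [pull, wordDeriv, one_mul]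
  | cons j l ih =>
    simp only [pull, wordDeriv]
    rw [mul_assoc, ← ih]
    ring

theorem wordMap_mem_interval (h : S.IsPath i l) (hx : x ∈ S.interval i) :
    S.wordMap i l x ∈ S.interval (endpoint i l) := by
  induction l generalizing i x with
  | nil => exact hx
  | cons j l ih => exact ih h.2 (φ_mem_interval h.1 hx)

theorem wordDeriv_ne_zero (h : S.IsPath i l) (hx : x ∈ S.interval i) : S.wordDeriv i l x ≠ 0 := by
  induction l generalizing i x with
  | nil => exact one_ne_zero
  | cons j l ih => exact mul_ne_zero (dφ_ne_zero h.1 hx) (ih h.2 (φ_mem_interval h.1 hx))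

theorem hasDerivWithinAt_wordMap (h : S.IsPath i l) (hx : x ∈ S.interval i) :
    HasDerivWithinAt (S.wordMap i l) (S.wordDeriv i l x) (S.interval i) x := by
  induction l generalizing i x with
  | nil => exact hasDerivWithinAt_id x _
  | cons j l ih =>
    rw [wordDeriv, mul_comm]
    exact (ih h.2 (φ_mem_interval h.1 hx)).comp x (hasDerivWithinAt_φ h.1 hx)
      fun _ => φ_mem_interval h.1

theorem exists_wordMap_sub_eq (h : S.IsPath i l) (hx : x ∈ S.interval i) (hy : y ∈ S.interval i) :
    ∃ z ∈ S.interval i, S.wordMap i l x - S.wordMap i l y = S.wordDeriv i l z * (x - y) :=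
  exists_sub_eq_mul_sub_of_hasDerivWithinAt ordConnected_Icc
    (fun _ => hasDerivWithinAt_wordMap h) hx hy

theorem abs_wordDeriv_le_pow (h : S.IsPath i l) (hx : x ∈ S.interval i) :
    |S.wordDeriv i l x| ≤ S.θ ^ l.length := by
  induction l generalizing i x with
  | nil => simp only [wordDeriv, abs_one, List.length_nil, pow_zero, le_refl]
  | cons j l ih =>
    rw [wordDeriv, abs_mul, List.length_cons, pow_succ']
    have := θ_pos (S := S)
    gcongr
    · exact abs_dφ_le h.1 hx
    · exact ih h.2 (φ_mem_interval h.1 hx)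

theorem abs_wordMap_sub_le (h : S.IsPath i l) (hx : x ∈ S.interval i) (hy : y ∈ S.interval i) :
    |S.wordMap i l x - S.wordMap i l y| ≤ S.θ ^ l.length * |x - y| := by
  obtain ⟨z, hz, hxy⟩ := exists_wordMap_sub_eq h hx hy
  rw [hxy, abs_mul]
  gcongr
  exact abs_wordDeriv_le_pow h hz

theorem abs_φ_sub_le (h : S.A i j = 1) (hx : x ∈ S.interval i) (hy : y ∈ S.interval i) :
    |S.φ i j x - S.φ i j y| ≤ S.θ * |x - y| := by
  simpa only [wordMap, List.length_singleton, pow_one] using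
    abs_wordMap_sub_le (l := [j]) ⟨h, trivial⟩ hx hy

/-! ### Derivative bounds -/

theorem exists_forall_le_abs_dφ :
    ∃ κ > 0, ∀ i j, S.A i j = 1 → ∀ x ∈ S.interval i, κ ≤ |S.dφ i j x| := by
  have hpair (i j : Fin N) :
      ∀ᶠ κ : ℝ in 𝓝[>] 0, S.A i j = 1 → ∀ x ∈ S.interval i, κ ≤ |S.dφ i j x| := by
    by_cases h : S.A i j = 1
    · obtain ⟨x, hx, hmin⟩ := (isCompact_interval i).exists_isMinOn ⟨_, left_mem_interval i⟩
        (contDiffOn_dφ h).continuousOn.abs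
      filter_upwards [Ioo_mem_nhdsGT (abs_pos.2 (dφ_ne_zero h hx))] with κ hκ _ y hy
      exact hκ.2.le.trans (hmin hy)
    · exact .of_forall fun κ h' => (h h').elim
  obtain ⟨κ, hκ, hpos⟩ := ((eventually_all.2 fun i => eventually_all.2 (hpair i)).and
    self_mem_nhdsWithin).exists
  exact ⟨κ, hpos, hκ⟩

variable (S) in
/-- A uniform lower bound of the derivatives `|dφ i j|`. -/
noncomputable def κ : ℝ := S.exists_forall_le_abs_dφ.choose

theorem κ_pos : 0 < S.κ := S.exists_forall_le_abs_dφ.choose_spec.1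

theorem κ_le_abs_dφ (h : S.A i j = 1) (hx : x ∈ S.interval i) : S.κ ≤ |S.dφ i j x| :=
  S.exists_forall_le_abs_dφ.choose_spec.2 i j h x hx

theorem κ_pow_le_abs_wordDeriv (h : S.IsPath i l) (hx : x ∈ S.interval i) :
    S.κ ^ l.length ≤ |S.wordDeriv i l x| := by
  induction l generalizing i x with
  | nil => simp only [wordDeriv, abs_one, List.length_nil, pow_zero, le_refl]
  | cons j l ih =>
    rw [wordDeriv, abs_mul, List.length_cons, pow_succ']
    have := κ_pos (S := S)
    gcongr
    · exact κ_le_abs_dφ h.1 hx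
    · exact ih h.2 (φ_mem_interval h.1 hx)

theorem exists_forall_abs_sub_le {ι : Type*} [Finite ι] {f : ι → ℝ → ℝ} {v : ι → Fin N}
    (hf : ∀ a, ContDiffOn ℝ 1 (f a) (S.interval (v a))) : ∃ L ≥ 0, ∀ a, ∀ x ∈ S.interval (v a),
      ∀ y ∈ S.interval (v a), |f a x - f a y| ≤ L * |x - y| := by
  have hlip (a : ι) : ∀ᶠ L : ℝ in atTop, ∀ x ∈ S.interval (v a), ∀ y ∈ S.interval (v a),
      |f a x - f a y| ≤ L * |x - y| := by
    obtain ⟨K, hK⟩ := (hf a).exists_lipschitzOnWith one_ne_zero (convex_Icc _ _)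
      (isCompact_interval _)
    filter_upwards [eventually_ge_atTop (K : ℝ)] with L hL x hx y hy
    exact (hK.dist_le_mul x hx y hy).trans (by rw [Real.dist_eq]; gcongr)
  obtain ⟨L, hL, hL0⟩ := ((eventually_all.2 hlip).and (eventually_ge_atTop 0)).exists
  exact ⟨L, hL0, hL⟩

theorem abs_log_wordDeriv_sub_le {L : ℝ} (hL : ∀ i j, S.A i j = 1 → ∀ x ∈ S.interval i,
    ∀ y ∈ S.interval i, |Real.log (S.dφ i j x) - Real.log (S.dφ i j y)| ≤ (1 - S.θ) * L * |x - y|)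
    (hL0 : 0 ≤ L) (h : S.IsPath i l) (hx : x ∈ S.interval i) (hy : y ∈ S.interval i) :
    |Real.log (S.wordDeriv i l x) - Real.log (S.wordDeriv i l y)| ≤ L * |x - y| := by
  induction l generalizing i x y with
  | nil => simpa only [wordDeriv, sub_self, abs_zero] using mul_nonneg hL0 (abs_nonneg _)
  | cons j l ih =>
    have hφx := φ_mem_interval h.1 hx
    have hφy := φ_mem_interval h.1 hy
    simp only [wordDeriv]
    rw [Real.log_mul (dφ_ne_zero h.1 hx) (wordDeriv_ne_zero h.2 hφx),
      Real.log_mul (dφ_ne_zero h.1 hy) (wordDeriv_ne_zero h.2 hφy), add_sub_add_comm]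
    calc _ ≤ (1 - S.θ) * L * |x - y| + L * |S.φ i j x - S.φ i j y| :=
          (abs_add_le _ _).trans (add_le_add (hL i j h.1 x hx y hy) (ih h.2 hφx hφy))
      _ ≤ (1 - S.θ) * L * |x - y| + L * (S.θ * |x - y|) := by
          gcongr
          exact abs_φ_sub_le h.1 hx hy
      _ = L * |x - y| := by ring

theorem exists_forall_abs_log_wordDeriv_sub_le :
    ∃ L ≥ 0, ∀ i l, S.IsPath i l → ∀ x ∈ S.interval i, ∀ y ∈ S.interval i,
      |Real.log (S.wordDeriv i l x) - Real.log (S.wordDeriv i l y)| ≤ L * |x - y| := by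
  obtain ⟨L, hL0, hL⟩ := exists_forall_abs_sub_le (ι := {p : Fin N × Fin N // S.A p.1 p.2 = 1})
    (f := fun p x => Real.log (S.dφ p.1.1 p.1.2 x)) fun p =>
      (contDiffOn_dφ p.2).log fun _ => dφ_ne_zero p.2
  have hθ : 0 < 1 - S.θ := sub_pos.2 θ_lt_one
  refine ⟨L / (1 - S.θ), by positivity, fun i l h x hx y hy =>
    abs_log_wordDeriv_sub_le (fun i j hij => ?_) (by positivity) h hx hy⟩
  rw [mul_div_cancel₀ _ hθ.ne']
  exact hL ⟨(i, j), hij⟩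

theorem exists_forall_abs_wordDeriv_le_mul : ∃ Q ≥ 1, ∀ i l, S.IsPath i l →
    ∀ x ∈ S.interval i, ∀ y ∈ S.interval i, |S.wordDeriv i l x| ≤ Q * |S.wordDeriv i l y| := by
  obtain ⟨L, hL0, hL⟩ := S.exists_forall_abs_log_wordDeriv_sub_le
  refine ⟨Real.exp (L * Metric.diam S.I), Real.one_le_exp (by positivity),
    fun i l h x hx y hy => ?_⟩
  have hxy : |x - y| ≤ Metric.diam S.I :=
    Metric.dist_le_diam_of_mem isCompact_I.isBounded (interval_subset_I i hx)
      (interval_subset_I i hy)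
  have hlog : Real.log (S.wordDeriv i l x) - Real.log (S.wordDeriv i l y) ≤
      L * Metric.diam S.I := (le_abs_self _).trans ((hL i l h x hx y hy).trans (by gcongr))
  rw [← Real.exp_log_eq_abs (wordDeriv_ne_zero h hx),
    ← Real.exp_log_eq_abs (wordDeriv_ne_zero h hy), ← Real.exp_add]
  exact Real.exp_le_exp.2 (sub_le_iff_le_add.1 hlog)

variable (S) in
/-- A distortion constant: along every path the derivative varies at most by the factor `Q`. -/
noncomputable def Q : ℝ := S.exists_forall_abs_wordDeriv_le_mul.choose

theorem one_le_Q : 1 ≤ S.Q := S.exists_forall_abs_wordDeriv_le_mul.choose_spec.1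

theorem Q_pos : 0 < S.Q := one_pos.trans_le one_le_Q

theorem abs_wordDeriv_le_mul (h : S.IsPath i l) (hx : x ∈ S.interval i) (hy : y ∈ S.interval i) :
    |S.wordDeriv i l x| ≤ S.Q * |S.wordDeriv i l y| :=
  S.exists_forall_abs_wordDeriv_le_mul.choose_spec.2 i l h x hx y hy

theorem abs_wordMap_sub_le_mul (h : S.IsPath i l) (hx : x ∈ S.interval i) (hy : y ∈ S.interval i) :
    |S.wordMap i l x - S.wordMap i l y| ≤ S.Q * |S.wordDeriv i l x| * |x - y| := by
  obtain ⟨z, hz, hxy⟩ := exists_wordMap_sub_eq h hx hy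
  rw [hxy, abs_mul]
  gcongr
  exact abs_wordDeriv_le_mul h hz hx

theorem abs_wordDeriv_mul_le (h : S.IsPath i l) (hx : x ∈ S.interval i) (hy : y ∈ S.interval i) :
    |S.wordDeriv i l x| * |x - y| ≤ S.Q * |S.wordMap i l x - S.wordMap i l y| := by
  obtain ⟨z, hz, hxy⟩ := exists_wordMap_sub_eq h hx hy
  rw [hxy, abs_mul, ← mul_assoc]
  gcongr
  exact abs_wordDeriv_le_mul h hx hz

/-! ### Separation of words -/

theorem exists_forall_gap_le_abs_sub : ∃ g > 0,
    (∀ i j, i ≠ j → ∀ x ∈ S.interval i, ∀ y ∈ S.interval j, g ≤ |x - y|) ∧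
    ∀ i j i' j', S.A i j = 1 → S.A i' j' = 1 → (i, j) ≠ (i', j') → ∀ x ∈ S.interval i,
      ∀ y ∈ S.interval i', g ≤ |S.φ i j x - S.φ i' j' y| := by
  obtain ⟨g₁, hg₁, hinterval⟩ := exists_pos_le_dist_of_pairwise_disjoint_isCompact
    (s := S.interval) isCompact_interval fun i j hij => S.disjoint_intervals i j hij
  obtain ⟨g₂, hg₂, himage⟩ := exists_pos_le_dist_of_pairwise_disjoint_isCompact
    (s := fun p : {p : Fin N × Fin N // S.A p.1 p.2 = 1} => S.φ p.1.1 p.1.2 '' S.interval p.1.1)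
    (fun p => (isCompact_interval _).image_of_continuousOn (S.φ_smooth _ _ p.2).continuousOn)
    fun p q hpq => disjoint_iff_inter_eq_empty.2 <| not_nonempty_iff_eq_empty.1 fun hne =>
      hpq (Subtype.ext (Prod.ext_iff.2 (S.separation _ _ _ _ p.2 q.2 hne)))
  exact ⟨min g₁ g₂, lt_min hg₁ hg₂,
    fun i j hij x hx y hy => (min_le_left _ _).trans (hinterval i j hij x hx y hy),
    fun i j i' j' h h' hne x hx y hy => (min_le_right _ _).trans <|
      himage ⟨_, h⟩ ⟨_, h'⟩ (fun heq => hne (congrArg Subtype.val heq)) _ (mem_image_of_mem _ hx) _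
        (mem_image_of_mem _ hy)⟩

variable (S) in
/-- A lower bound for the mutual distances of the intervals `I_i` and of the sets
`φ i j (I_i)`. -/
noncomputable def gap : ℝ := S.exists_forall_gap_le_abs_sub.choose

theorem gap_pos : 0 < S.gap := S.exists_forall_gap_le_abs_sub.choose_spec.1

theorem gap_le_abs_sub (hij : i ≠ j) (hx : x ∈ S.interval i) (hy : y ∈ S.interval j) :
    S.gap ≤ |x - y| :=
  S.exists_forall_gap_le_abs_sub.choose_spec.2.1 i j hij x hx y hy

theorem gap_le_abs_φ_sub {i j i' j' : Fin N} (h : S.A i j = 1) (h' : S.A i' j' = 1)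
    (hne : (i, j) ≠ (i', j')) (hx : x ∈ S.interval i) (hy : y ∈ S.interval i') :
    S.gap ≤ |S.φ i j x - S.φ i' j' y| :=
  S.exists_forall_gap_le_abs_sub.choose_spec.2.2 i j i' j' h h' hne x hx y hy

theorem gap_mul_abs_wordDeriv_le (hlen : l.length = l'.length) (hne : (i, l) ≠ (i', l'))
    (h : S.IsPath i l) (h' : S.IsPath i' l') (hx : x ∈ S.interval i) (hy : y ∈ S.interval i') :
    S.gap * |S.wordDeriv i l x| ≤ S.Q * |S.wordMap i l x - S.wordMap i' l' y| := by
  have hg := gap_pos (S := S)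
  induction l generalizing i i' l' x y with
  | nil =>
    obtain rfl := List.length_eq_zero_iff.1 hlen.symm
    rw [wordDeriv, abs_one, mul_one]
    exact (gap_le_abs_sub (fun heq => hne (by rw [heq])) hx hy).trans
      (le_mul_of_one_le_left (abs_nonneg _) one_le_Q)
  | cons j l ih =>
    obtain ⟨j', l', rfl⟩ := List.exists_cons_of_length_eq_add_one hlen.symm
    have hφx := φ_mem_interval h.1 hx
    have hφy := φ_mem_interval h'.1 hy
    have hle : |S.wordDeriv i (j :: l) x| ≤ |S.wordDeriv j l (S.φ i j x)| := by
      rw [wordDeriv, abs_mul]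
      exact mul_le_of_le_one_left (abs_nonneg _) ((abs_dφ_le h.1 hx).trans θ_lt_one.le)
    refine (mul_le_mul_of_nonneg_left hle hg.le).trans ?_
    by_cases heq : (j, l) = (j', l')
    · obtain ⟨rfl, rfl⟩ := Prod.mk.injEq .. ▸ heq
      have hedge : (i, j) ≠ (i', j) := fun hij => hne (by rw [(Prod.mk.inj hij).1])
      refine le_trans ?_ (abs_wordDeriv_mul_le h.2 hφx hφy)
      rw [mul_comm]
      gcongr
      exact gap_le_abs_φ_sub h.1 h'.1 hedge hx hy
    · exact ih (i' := j') (l' := l') (by simpa only [List.length_cons, Nat.add_right_cancel_iff]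
        using hlen) heq h.2 h'.2 hφx hφy

end IteratedFunctionScheme

namespace IteratedFunctionScheme

variable {N : ℕ} {S : IteratedFunctionScheme N} {τ : ℝ → ℝ} {i j : Fin N} {l : List (Fin N)}
  {x ξ η R R' : ℝ} {p q : ℝ × ℝ}

/-! ### Bounds in the fibres -/

variable (S) in
/-- The interval `[-R, R]` of fibre coordinates is mapped into itself by `pull`. -/
def IsFiberBound (τ : ℝ → ℝ) (R : ℝ) : Prop :=
  ∀ x ∈ S.I, S.θ * (R + |derivWithin τ S.I x|) ≤ R

theorem continuousOn_derivWithin_I (hτ : ContDiffOn ℝ 2 τ S.I) :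
    ContinuousOn (derivWithin τ S.I) S.I := by
  intro x hx
  obtain ⟨i, hi⟩ := mem_iUnion.1 hx
  exact ((contDiffOn_derivWithin_I hτ i).continuousOn x hi).congr_set
    (I_eventuallyEq_interval hi).symm

theorem exists_isFiberBound (hτ : ContDiffOn ℝ 2 τ S.I) : ∃ R, S.IsFiberBound τ R := by
  obtain ⟨T, hT⟩ := isCompact_I.exists_bound_of_continuousOn (continuousOn_derivWithin_I hτ)
  have hθ : 0 < 1 - S.θ := sub_pos.2 θ_lt_one
  refine ⟨S.θ * T / (1 - S.θ), fun x hx => ?_⟩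
  calc S.θ * (S.θ * T / (1 - S.θ) + |derivWithin τ S.I x|)
      ≤ S.θ * (S.θ * T / (1 - S.θ) + T) := by
        gcongr
        exacts [θ_pos.le, hT x hx]
    _ = S.θ * T / (1 - S.θ) := by
        field_simp
        ring

theorem exists_abs_step_sub_step_le (hτ : ContDiffOn ℝ 2 τ S.I) (R : ℝ) : ∃ L ≥ 0, ∀ i j,
    S.A i j = 1 → ∀ x ∈ S.interval i, ∀ y ∈ S.interval i, ∀ η η', |η| ≤ R →
      |S.dφ i j x * (η - derivWithin τ S.I (S.φ i j x)) -
        S.dφ i j y * (η' - derivWithin τ S.I (S.φ i j y))| ≤ L * |x - y| + S.θ * |η - η'| := by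
  let E := {p : Fin N × Fin N // S.A p.1 p.2 = 1}
  let shift (p : E) (x : ℝ) := S.dφ p.1.1 p.1.2 x * derivWithin τ S.I (S.φ p.1.1 p.1.2 x)
  have hshift (p : E) : ContDiffOn ℝ 1 (shift p) (S.interval p.1.1) :=
    (contDiffOn_dφ p.2).mul ((contDiffOn_derivWithin_I hτ p.1.2).comp
      ((S.φ_smooth _ _ p.2).of_le (by norm_cast)) fun _ => φ_mem_interval p.2)
  obtain ⟨L, hL0, hL⟩ := exists_forall_abs_sub_le fun p : E => contDiffOn_dφ p.2
  obtain ⟨L', hL'0, hL'⟩ := exists_forall_abs_sub_le hshift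
  refine ⟨L * |R| + L', by positivity, fun i j h x hx y hy η η' hη => ?_⟩
  calc |S.dφ i j x * (η - derivWithin τ S.I (S.φ i j x)) -
        S.dφ i j y * (η' - derivWithin τ S.I (S.φ i j y))|
      = |(S.dφ i j x - S.dφ i j y) * η + S.dφ i j y * (η - η')
          - (shift ⟨(i, j), h⟩ x - shift ⟨(i, j), h⟩ y)| := by
        simp only [shift]
        ring_nf
    _ ≤ |S.dφ i j x - S.dφ i j y| * |η| + |S.dφ i j y| * |η - η'|
          + |shift ⟨(i, j), h⟩ x - shift ⟨(i, j), h⟩ y| := by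
        rw [← abs_mul, ← abs_mul]
        exact (abs_sub _ _).trans (by gcongr; exact abs_add_le _ _)
    _ ≤ L * |x - y| * |R| + S.θ * |η - η'| + L' * |x - y| := by
        have hηR : |η| ≤ |R| := hη.trans (le_abs_self R)
        gcongr
        · exact hL ⟨(i, j), h⟩ x hx y hy
        · exact abs_dφ_le h hy
        · exact hL' ⟨(i, j), h⟩ x hx y hy
    _ = (L * |R| + L') * |x - y| + S.θ * |η - η'| := by ring

namespace IsFiberBound

theorem nonneg (hR : S.IsFiberBound τ R) : 0 ≤ R := by
  have hi := left_mem_interval (S := S) ⟨0, S.one_le⟩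
  have := hR _ (interval_subset_I _ hi)
  nlinarith [θ_pos (S := S), θ_lt_one (S := S), abs_nonneg (derivWithin τ S.I (S.a ⟨0, S.one_le⟩))]

theorem mono (hR : S.IsFiberBound τ R) (hRR' : R ≤ R') : S.IsFiberBound τ R' := fun x hx => by
  nlinarith [hR x hx, θ_lt_one (S := S)]

theorem abs_step_le (hR : S.IsFiberBound τ R) (h : S.A i j = 1) (hx : x ∈ S.interval i)
    (hη : |η| ≤ R) : |S.dφ i j x * (η - derivWithin τ S.I (S.φ i j x))| ≤ R := by
  rw [abs_mul]
  refine le_trans ?_ (hR _ (interval_subset_I j (φ_mem_interval h hx)))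
  have := θ_pos (S := S)
  gcongr
  · exact abs_dφ_le h hx
  · exact (abs_sub _ _).trans (by gcongr)

theorem abs_pull_le (hR : S.IsFiberBound τ R) (h : S.IsPath i l) (hx : x ∈ S.interval i)
    (hη : |η| ≤ R) : |S.pull τ i l x η| ≤ R := by
  induction l generalizing i x with
  | nil => exact hη
  | cons j l ih => exact hR.abs_step_le h.1 hx (ih h.2 (φ_mem_interval h.1 hx))

theorem exists_abs_pull_sub_pull_le (hR : S.IsFiberBound τ R) (hτ : ContDiffOn ℝ 2 τ S.I) :
    ∃ Λ ≥ 0, ∀ i l, S.IsPath i l → ∀ x ∈ S.interval i, ∀ y ∈ S.interval i, ∀ η, |η| ≤ R →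
      |S.pull τ i l x η - S.pull τ i l y η| ≤ Λ * |x - y| := by
  obtain ⟨L, hL0, hL⟩ := exists_abs_step_sub_step_le hτ R
  have hθ : 0 < 1 - S.θ := sub_pos.2 θ_lt_one
  have hθ0 := θ_pos (S := S)
  have hΛ0 : 0 ≤ L / (1 - S.θ) := by positivity
  refine ⟨L / (1 - S.θ), hΛ0, fun i l h x hx y hy η hη => ?_⟩
  induction l generalizing i x y with
  | nil => simpa only [pull, sub_self, abs_zero] using mul_nonneg hΛ0 (abs_nonneg _)
  | cons j l ih =>
    have hφx := φ_mem_interval h.1 hx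
    have hφy := φ_mem_interval h.1 hy
    have hφ : |S.φ i j x - S.φ i j y| ≤ |x - y| := (abs_φ_sub_le h.1 hx hy).trans
      (mul_le_of_le_one_left (abs_nonneg _) θ_lt_one.le)
    calc |S.pull τ i (j :: l) x η - S.pull τ i (j :: l) y η|
        ≤ L * |x - y| + S.θ * (L / (1 - S.θ) * |x - y|) := by
          refine (hL i j h.1 x hx y hy _ _ (hR.abs_pull_le h.2 hφx hη)).trans ?_
          gcongr
          exact (ih j h.2 _ hφx _ hφy).trans (by gcongr)
      _ = L / (1 - S.θ) * |x - y| := by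
          field_simp
          ring

end IsFiberBound

/-! ### The trapped sets -/

theorem Kn_succ (n : ℕ) : S.Kn (n + 1) = S.image (S.Kn n) :=
  Function.iterate_succ_apply' _ _ _

theorem image_subset_I (s : Set ℝ) : S.image s ⊆ S.I := by
  rintro _ ⟨i, j, h, x, hx, rfl⟩
  exact interval_subset_I j (φ_mem_interval h hx.2)

theorem image_mono : Monotone S.image := by
  rintro s t hst _ ⟨i, j, h, x, hx, rfl⟩
  exact ⟨i, j, h, x, ⟨hst hx.1, hx.2⟩, rfl⟩

theorem Kn_antitone : Antitone S.Kn :=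
  image_mono.antitone_iterate_of_map_le (image_subset_I _)

theorem K_subset_I : S.K ⊆ S.I := iInter_subset _ 0

theorem φ_mem_Kn_succ_iff (h : S.A i j = 1) (hx : x ∈ S.interval i) {n : ℕ} :
    S.φ i j x ∈ S.Kn (n + 1) ↔ x ∈ S.Kn n := by
  rw [Kn_succ]
  refine ⟨?_, fun hn => ⟨i, j, h, x, ⟨hn, hx⟩, rfl⟩⟩
  rintro ⟨k, m, hkm, y, ⟨hn, hy⟩, hyx⟩
  obtain ⟨rfl, rfl⟩ := S.separation k m i j hkm h ⟨S.φ i j x, ⟨y, hy, hyx⟩, ⟨x, hx, rfl⟩⟩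
  rwa [← S.φ_injOn _ _ h hy hx hyx]

theorem φ_mem_K_iff (h : S.A i j = 1) (hx : x ∈ S.interval i) : S.φ i j x ∈ S.K ↔ x ∈ S.K := by
  simp only [K, mem_iInter]
  refine ⟨fun hφ n => (φ_mem_Kn_succ_iff h hx).1 (hφ _), fun hn n => ?_⟩
  exact Kn_antitone n.le_succ ((φ_mem_Kn_succ_iff h hx).2 (hn n))

theorem wordMap_mem_K_iff (h : S.IsPath i l) (hx : x ∈ S.interval i) :
    S.wordMap i l x ∈ S.K ↔ x ∈ S.K := by
  induction l generalizing i x with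
  | nil => rfl
  | cons j l ih => exact (ih h.2 (φ_mem_interval h.1 hx)).trans (φ_mem_K_iff h.1 hx)

theorem wordMap_mem_Kn (h : S.IsPath i l) (hx : x ∈ S.interval i) {n : ℕ} (hxn : x ∈ S.Kn n) :
    S.wordMap i l x ∈ S.Kn (n + l.length) := by
  induction l using List.reverseRecOn with
  | nil => exact hxn
  | append_singleton l j ih =>
    rw [isPath_append] at h
    rw [wordMap_append, List.length_append]
    exact (φ_mem_Kn_succ_iff h.2.1 (wordMap_mem_interval h.1 hx)).2 (ih h.1)

theorem exists_preimage_mem_K (hx : x ∈ S.K) :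
    ∃ i j, S.A i j = 1 ∧ ∃ y ∈ S.K ∩ S.interval i, S.φ i j y = x := by
  obtain ⟨i, j, h, y, hy, rfl⟩ : x ∈ S.image (S.Kn 0) := mem_iInter.1 hx 1
  exact ⟨i, j, h, y, ⟨(φ_mem_K_iff h hy.2).1 hx, hy.2⟩, rfl⟩

theorem exists_word_of_mem_K (hx : x ∈ S.K) (n : ℕ) :
    ∃ i l, l.length = n ∧ S.IsPath i l ∧ ∃ y ∈ S.K ∩ S.interval i, S.wordMap i l y = x := by
  induction n with
  | zero =>
    obtain ⟨i, hi⟩ := mem_iUnion.1 (K_subset_I hx)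
    exact ⟨i, [], rfl, trivial, x, ⟨hx, hi⟩, rfl⟩
  | succ n ih =>
    obtain ⟨i, l, rfl, h, y, hy, rfl⟩ := ih
    obtain ⟨k, j, hkj, z, hz, rfl⟩ := exists_preimage_mem_K hy.1
    obtain rfl := eq_of_mem_interval hy.2 (φ_mem_interval hkj hz.2)
    exact ⟨k, i :: l, rfl, ⟨hkj, h⟩, z, hz, rfl⟩

theorem mem_canonicalMap_iff : q ∈ S.canonicalMap τ p ↔ ∃ i j, S.A i j = 1 ∧
    p.1 ∈ S.interval i ∧ q.1 = S.φ i j p.1 ∧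
      p.2 = S.dφ i j p.1 * (q.2 - derivWithin τ S.I (S.φ i j p.1)) := by
  refine exists_congr fun i => exists_congr fun j => and_congr_right fun h =>
    and_congr_right fun hp => Prod.ext_iff.trans (and_congr_right fun _ => ?_)
  have hne : S.dφ i j p.1 ≠ 0 := dφ_ne_zero h hp
  change q.2 = (S.dφ i j p.1)⁻¹ * p.2 + derivWithin τ S.I (S.φ i j p.1) ↔ _
  rw [← sub_eq_iff_eq_add, eq_inv_mul_iff_mul_eq₀ hne, eq_comm]

theorem mem_iterate_canonicalImage_iff (hp : p.1 ∈ S.I) {n : ℕ} :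
    q ∈ (S.canonicalImage τ)^[n] {p} ↔ ∃ i l, l.length = n ∧ S.IsPath i l ∧ p.1 ∈ S.interval i ∧
      q.1 = S.wordMap i l p.1 ∧ p.2 = S.pull τ i l p.1 q.2 := by
  induction n generalizing q with
  | zero =>
    rw [Function.iterate_zero_apply, mem_singleton_iff]
    constructor
    · rintro rfl
      obtain ⟨i, hi⟩ := mem_iUnion.1 hp
      exact ⟨i, [], rfl, trivial, hi, rfl, rfl⟩
    · rintro ⟨i, l, hl, -, -, hfst, hsnd⟩
      obtain rfl := List.length_eq_zero_iff.1 hl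
      exact Prod.ext hfst hsnd.symm
  | succ n ih =>
    rw [Function.iterate_succ_apply', canonicalImage, mem_iUnion₂]
    constructor
    · rintro ⟨q', hq', hq⟩
      obtain ⟨i, l, rfl, hpath, hi, hfst, hsnd⟩ := ih.1 hq'
      obtain ⟨k, j, hkj, hk, hfst', hsnd'⟩ := mem_canonicalMap_iff.1 hq
      rw [hfst] at hk hfst' hsnd'
      obtain rfl : k = endpoint i l := eq_of_mem_interval hk (wordMap_mem_interval hpath hi)
      refine ⟨i, l ++ [j], List.length_append, isPath_append.2 ⟨hpath, hkj, trivial⟩, hi, ?_, ?_⟩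
      · rw [wordMap_append, hfst', wordMap, wordMap]
      · rw [pull_append, hsnd, hsnd', pull, pull]
    · rintro ⟨i, l', hl', hpath, hi, hfst, hsnd⟩
      obtain ⟨l, j, rfl⟩ := (List.eq_nil_or_concat' l').resolve_left (by rintro rfl; cases hl')
      rw [isPath_append] at hpath
      rw [wordMap_append] at hfst
      rw [pull_append] at hsnd
      exact ⟨(S.wordMap i l p.1, S.pull τ (endpoint i l) [j] (S.wordMap i l p.1) q.2),
        ih.2 ⟨i, l, by simpa using hl', hpath.1, hi, rfl, hsnd⟩, mem_canonicalMap_iff.2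
          ⟨endpoint i l, j, hpath.2.1, wordMap_mem_interval hpath.1 hi, hfst, rfl⟩⟩

theorem exists_forall_eq_pull_of_mem_phaseTrapped (hp : p ∈ S.phaseTrapped τ) :
    p.1 ∈ S.K ∧ ∃ M, ∀ n, ∃ i l η, l.length = n ∧ S.IsPath i l ∧ p.1 ∈ S.interval i ∧
      |η| ≤ M ∧ p.2 = S.pull τ i l p.1 η := by
  obtain ⟨⟨hpI, -⟩, C, hC, hcomp, h⟩ := hp
  obtain ⟨M, hM⟩ := hcomp.isBounded.exists_norm_le
  refine ⟨mem_iInter.2 fun n => ?_, M, fun n => ?_⟩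
  · cases n with
    | zero => exact hpI
    | succ n =>
      obtain ⟨q, hq, hqC⟩ := h (Int.negSucc n)
      obtain ⟨i, l, hl, hpath, hi, hfst, -⟩ := (mem_iterate_canonicalImage_iff (hC hqC).1).1 hq
      rw [hfst, ← hl]
      simpa only [zero_add] using wordMap_mem_Kn (n := 0) hpath hi (interval_subset_I i hi)
  · obtain ⟨q, hq, hqC⟩ := h (Int.ofNat n)
    obtain ⟨i, l, hl, hpath, hi, -, hsnd⟩ := (mem_iterate_canonicalImage_iff hpI).1 hq
    exact ⟨i, l, q.2, hl, hpath, hi, (norm_snd_le q).trans (hM q hqC), hsnd⟩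

theorem IsFiberBound.mem_phaseTrapped_iff (hR : S.IsFiberBound τ R) : p ∈ S.phaseTrapped τ ↔
    p.1 ∈ S.K ∧ ∃ M, ∀ n, ∃ i l η, l.length = n ∧ S.IsPath i l ∧ p.1 ∈ S.interval i ∧
      |η| ≤ M ∧ p.2 = S.pull τ i l p.1 η := by
  refine ⟨exists_forall_eq_pull_of_mem_phaseTrapped, fun ⟨hK, M, h⟩ => ?_⟩
  have hpI := K_subset_I hK
  set R' := max R (max M |p.2|) with hR'
  have hbound : S.IsFiberBound τ R' := hR.mono (le_max_left _ _)
  refine ⟨⟨hpI, trivial⟩, S.I ×ˢ Icc (-R') R', prod_mono_right (subset_univ _),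
    isCompact_I.prod isCompact_Icc, ?_⟩
  rintro (n | n)
  · obtain ⟨i, l, η, hl, hpath, hi, hη, hsnd⟩ := h n
    exact ⟨(S.wordMap i l p.1, η), (mem_iterate_canonicalImage_iff hpI).2
      ⟨i, l, hl, hpath, hi, rfl, hsnd⟩, interval_subset_I _ (wordMap_mem_interval hpath hi),
      abs_le.1 (hη.trans (by simp [hR']))⟩
  · obtain ⟨i, l, hl, hpath, y, hy, hyp⟩ := exists_word_of_mem_K hK (n + 1)
    exact ⟨(y, S.pull τ i l y p.2), (mem_iterate_canonicalImage_iff (K_subset_I hy.1)).2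
      ⟨i, l, hl, hpath, hy.2, hyp.symm, rfl⟩, K_subset_I hy.1,
      abs_le.1 (hbound.abs_pull_le hpath hy.2 (by simp [hR']))⟩

theorem IsFiberBound.pull_mem_phaseTrapped (hR : S.IsFiberBound τ R) (h : S.IsPath i l)
    (hx : x ∈ S.interval i) (hη : (S.wordMap i l x, η) ∈ S.phaseTrapped τ) :
    (x, S.pull τ i l x η) ∈ S.phaseTrapped τ := by
  induction l generalizing i x with
  | nil => exact hη
  | cons j l ih =>
    obtain ⟨hK, M, hM⟩ := hR.mem_phaseTrapped_iff.1 (ih h.2 (φ_mem_interval h.1 hx) hη)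
    refine hR.mem_phaseTrapped_iff.2 ⟨(φ_mem_K_iff h.1 hx).1 hK,
      max M |S.pull τ i (j :: l) x η|, fun n => ?_⟩
    cases n with
    | zero => exact ⟨i, [], _, rfl, trivial, hx, le_max_right _ _, rfl⟩
    | succ n =>
      obtain ⟨k, l', η', hl', hpath, hk, hη', heq⟩ := hM n
      obtain rfl := eq_of_mem_interval (φ_mem_interval h.1 hx) hk
      refine ⟨i, j :: l', η', congrArg (· + 1) hl', ⟨h.1, hpath⟩, hx,
        hη'.trans (le_max_left _ _), ?_⟩
      simp only [pull] at heq ⊢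
      rw [heq]

theorem IsFiberBound.exists_eq_pull_of_mem_phaseTrapped (hR : S.IsFiberBound τ R)
    (hp : (x, ξ) ∈ S.phaseTrapped τ) (n : ℕ) : ∃ i l η, l.length = n ∧ S.IsPath i l ∧
      x ∈ S.interval i ∧ |η| ≤ R + 1 ∧ ξ = S.pull τ i l x η := by
  obtain ⟨-, M, hM⟩ := hR.mem_phaseTrapped_iff.1 hp
  obtain ⟨m, hm⟩ := (((tendsto_pow_atTop_nhds_zero_of_lt_one θ_pos.le
    (θ_lt_one (S := S))).mul_const M).eventually_le_const (zero_mul M ▸ one_pos)).exists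
  obtain ⟨i, l, η, hlen, h, (hx : x ∈ S.interval i), hη, (hξ : ξ = S.pull τ i l x η)⟩ := hM (n + m)
  rw [← l.take_append_drop n, isPath_append] at h
  rw [← l.take_append_drop n, pull_append] at hξ
  set y := S.wordMap i (l.take n) x
  set k := endpoint i (l.take n)
  have hy : y ∈ S.interval k := wordMap_mem_interval h.1 hx
  refine ⟨i, l.take n, _, by simp [hlen], h.1, hx, ?_, hξ⟩
  calc |S.pull τ k (l.drop n) y η|
      = |S.pull τ k (l.drop n) y 0 + S.wordDeriv k (l.drop n) y * (η - 0)| := by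
        rw [← pull_sub_pull τ, add_sub_cancel]
    _ ≤ R + S.θ ^ (l.drop n).length * M := by
        refine (abs_add_le _ _).trans ?_
        rw [abs_mul, sub_zero]
        have := θ_pos (S := S)
        gcongr
        · exact hR.abs_pull_le h.2 hy (by simpa using hR.nonneg)
        · exact abs_wordDeriv_le_pow h.2 hy
    _ ≤ R + 1 := by
        rw [List.length_drop, hlen, Nat.add_sub_cancel_left]
        gcongr

end IteratedFunctionScheme

namespace IteratedFunctionScheme

variable {N : ℕ} {S : IteratedFunctionScheme N} {τ : ℝ → ℝ} {i j j' : Fin N}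
  {l l' : List (Fin N)} {x η η' R ε : ℝ}

variable (S) in
/-- Every edge of the graph lies on a closed path: each connected component of the graph is
strongly connected. -/
def IsRecurrent : Prop := ∀ i j, S.A i j = 1 → ∃ l, S.IsPath j l ∧ endpoint j l = i

theorem isRecurrent_of_isSymm (hA : S.A.IsSymm) : S.IsRecurrent := fun i j h =>
  ⟨[i], ⟨(hA.apply i j).trans h, trivial⟩, rfl⟩

theorem IsRecurrent.exists_path_of_isPath (hrec : S.IsRecurrent) (h : S.IsPath i l) :
    ∃ l', S.IsPath (endpoint i l) l' ∧ endpoint (endpoint i l) l' = i := by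
  induction l generalizing i with
  | nil => exact ⟨[], trivial, rfl⟩
  | cons j l ih =>
    obtain ⟨l₁, hpath₁, hend₁⟩ := ih h.2
    obtain ⟨l₂, hpath₂, hend₂⟩ := hrec i j h.1
    exact ⟨l₁ ++ l₂, isPath_append.2 ⟨hpath₁, hend₁.symm ▸ hpath₂⟩, by
      rw [endpoint, endpoint_append, hend₁, hend₂]⟩

theorem IsRecurrent.exists_successor (hrec : S.IsRecurrent) (hi : x ∈ S.interval i)
    (hx : x ∈ S.K) : ∃ j, S.A i j = 1 := by
  obtain ⟨k, j, h, z, hz, rfl⟩ := exists_preimage_mem_K hx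
  obtain rfl := eq_of_mem_interval hi (φ_mem_interval h hz.2)
  obtain ⟨_ | ⟨j, l⟩, hpath, hend⟩ := hrec k i h
  · obtain rfl : i = k := hend
    exact ⟨i, h⟩
  · exact ⟨j, hpath.1⟩

theorem IsRecurrent.exists_mem_phaseTrapped (hrec : S.IsRecurrent) (hR : S.IsFiberBound τ R)
    (hx : x ∈ S.K) : ∃ ξ, (x, ξ) ∈ S.phaseTrapped τ := by
  let P := {p : Fin N × ℝ // p.2 ∈ S.interval p.1 ∧ p.2 ∈ S.K}
  choose succ hsucc using fun p : P => hrec.exists_successor p.2.1 p.2.2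
  let T (p : P) : P := ⟨(succ p, S.φ p.1.1 (succ p) p.1.2),
    φ_mem_interval (hsucc p) p.2.1, (φ_mem_K_iff (hsucc p) p.2.1).2 p.2.2⟩
  let step (p : P) (η : Icc (-R) R) : Icc (-R) R :=
    ⟨S.dφ p.1.1 (succ p) p.1.2 * (η - derivWithin τ S.I (T p).1.2),
      abs_le.1 (hR.abs_step_le (hsucc p) p.2.1 (abs_le.2 η.2))⟩
  have hstep (p : P) : LipschitzWith ⟨S.θ, θ_pos.le⟩ (step p) := .of_dist_le_mul fun η η' => by
    simp only [Subtype.dist_eq, Real.dist_eq, step]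
    rw [← mul_sub, sub_sub_sub_cancel_right, abs_mul]
    exact mul_le_mul_of_nonneg_right (abs_dφ_le (hsucc p) p.2.1) (abs_nonneg _)
  have : Nonempty (Icc (-R) R) := ⟨⟨0, by simpa using hR.nonneg⟩⟩
  obtain ⟨ζ, hζ⟩ := exists_forall_eq_apply_of_lipschitzWith
    (show (⟨S.θ, θ_pos.le⟩ : ℝ≥0) < 1 from θ_lt_one) T hstep
  have hpull (n : ℕ) (p : P) : ∃ l η, l.length = n ∧ S.IsPath p.1.1 l ∧ |η| ≤ R ∧
      ζ p = S.pull τ p.1.1 l p.1.2 η := by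
    induction n generalizing p with
    | zero => exact ⟨[], ζ p, rfl, trivial, abs_le.2 (ζ p).2, rfl⟩
    | succ n ih =>
      obtain ⟨l, η, rfl, hpath, hη, heq⟩ := ih (T p)
      refine ⟨succ p :: l, η, rfl, ⟨hsucc p, hpath⟩, hη, ?_⟩
      rw [hζ p, pull, ← heq]
  obtain ⟨i, hi⟩ := mem_iUnion.1 (K_subset_I hx)
  refine ⟨ζ ⟨(i, x), hi, hx⟩, hR.mem_phaseTrapped_iff.2 ⟨hx, R, fun n => ?_⟩⟩
  obtain ⟨l, η, hlen, hpath, hη, heq⟩ := hpull n ⟨(i, x), hi, hx⟩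
  exact ⟨i, l, η, hlen, hpath, hi, hη, heq⟩

/-! ### Minimal captivity -/

variable (S) in
/-- Minimal captivity at the scale `ε`. -/
def MinimallyCaptiveAt (τ : ℝ → ℝ) (ε : ℝ) : Prop :=
  ∀ p ∈ S.phaseTrappedNhd τ ε, (S.canonicalMap τ p ∩ S.phaseTrappedNhd τ ε).encard ≤ 1

theorem phaseTrapped_subset_phaseTrappedNhd (hε : 0 ≤ ε) :
    S.phaseTrapped τ ⊆ S.phaseTrappedNhd τ ε := fun p hp =>
  ⟨hp.1, p, hp, by simpa only [sub_self, abs_zero, max_self] using hε⟩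

/-- If the two fibre points were close, then the branches `i ⇝ j` and `i ⇝ j'` of `F` would both
move the first one into the neighbourhood of the trapped set. -/
theorem MinimallyCaptiveAt.mul_le_abs_step_sub (hcap : S.MinimallyCaptiveAt τ ε) (hε : 0 ≤ ε)
    (hj : j ≠ j') (h : S.A i j = 1) (h' : S.A i j' = 1) (hx : x ∈ S.interval i)
    (hξ : (x, S.dφ i j x * (η - derivWithin τ S.I (S.φ i j x))) ∈ S.phaseTrapped τ)
    (hη : (S.φ i j x, η) ∈ S.phaseTrapped τ) (hη' : (S.φ i j' x, η') ∈ S.phaseTrapped τ) :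
    S.κ * ε ≤ |S.dφ i j x * (η - derivWithin τ S.I (S.φ i j x)) -
      S.dφ i j' x * (η' - derivWithin τ S.I (S.φ i j' x))| := by
  by_contra! hlt
  set ξ := S.dφ i j x * (η - derivWithin τ S.I (S.φ i j x))
  have hne : S.dφ i j' x ≠ 0 := dφ_ne_zero h' hx
  set ζ := (S.dφ i j' x)⁻¹ * ξ + derivWithin τ S.I (S.φ i j' x) with hζ
  have hζη : S.dφ i j' x * (ζ - η') =
      ξ - S.dφ i j' x * (η' - derivWithin τ S.I (S.φ i j' x)) := by
    rw [hζ]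
    field_simp
    ring
  have hclose : |ζ - η'| ≤ ε := by
    refine le_of_mul_le_mul_left ?_ (abs_pos.2 hne)
    rw [← abs_mul, hζη]
    exact hlt.le.trans (mul_le_mul_of_nonneg_right (κ_le_abs_dφ h' hx) hε)
  have hmem : (S.φ i j x, η) ∈ S.canonicalMap τ (x, ξ) ∩ S.phaseTrappedNhd τ ε :=
    ⟨mem_canonicalMap_iff.2 ⟨i, j, h, hx, rfl, rfl⟩, phaseTrapped_subset_phaseTrappedNhd hε hη⟩
  have hmem' : (S.φ i j' x, ζ) ∈ S.canonicalMap τ (x, ξ) ∩ S.phaseTrappedNhd τ ε :=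
    ⟨⟨i, j', h', hx, rfl⟩, ⟨interval_subset_I j' (φ_mem_interval h' hx), trivial⟩, _, hη',
      max_le (by simpa only [sub_self, abs_zero] using hε) hclose⟩
  have heq := Set.encard_le_one_iff.1
    (hcap (x, ξ) (phaseTrapped_subset_phaseTrappedNhd hε hξ)) _ _ hmem hmem'
  exact hj (S.separation i j i j' h h'
    ⟨S.φ i j x, ⟨x, hx, rfl⟩, ⟨x, hx, (congrArg Prod.fst heq).symm⟩⟩).2

theorem MinimallyCaptiveAt.mul_abs_wordDeriv_le (hcap : S.MinimallyCaptiveAt τ ε) (hε : 0 ≤ ε)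
    (hR : S.IsFiberBound τ R) (hlen : l.length = l'.length) (hne : l ≠ l') (h : S.IsPath i l)
    (h' : S.IsPath i l') (hx : x ∈ S.interval i) (hη : (S.wordMap i l x, η) ∈ S.phaseTrapped τ)
    (hη' : (S.wordMap i l' x, η') ∈ S.phaseTrapped τ) :
    S.κ * ε * |S.wordDeriv i l x| ≤ |S.pull τ i l x η - S.pull τ i l' x η'| := by
  have hκ := κ_pos (S := S)
  induction l generalizing i x l' with
  | nil => exact (hne (List.length_eq_zero_iff.1 hlen.symm).symm).elim
  | cons j l ih =>
    obtain ⟨j', l', rfl⟩ := List.exists_cons_of_length_eq_add_one hlen.symm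
    have hφx := φ_mem_interval h.1 hx
    by_cases hj : j = j'
    · subst hj
      have := ih (Nat.succ.inj hlen) (fun heq => hne (by rw [heq])) h.2 h'.2 hφx hη hη'
      simp only [pull, wordDeriv]
      rw [← mul_sub, sub_sub_sub_cancel_right, abs_mul, abs_mul, mul_left_comm]
      gcongr
    · have hderiv : |S.wordDeriv i (j :: l) x| ≤ 1 :=
        (abs_wordDeriv_le_pow h hx).trans (pow_le_one₀ θ_pos.le θ_lt_one.le)
      refine (mul_le_of_le_one_right (by positivity) hderiv).trans ?_
      exact hcap.mul_le_abs_step_sub hε hj h.1 h'.1 hx (hR.pull_mem_phaseTrapped h hx hη)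
        (hR.pull_mem_phaseTrapped h.2 hφx hη)
        (hR.pull_mem_phaseTrapped h'.2 (φ_mem_interval h'.1 hx) hη')

end IteratedFunctionScheme

/-! ### Free families of loops -/

namespace IteratedFunctionScheme

variable {N : ℕ} {S : IteratedFunctionScheme N} {τ : ℝ → ℝ} {i : Fin N} {n n' : ℕ}
  {W W' : Finset (List (Fin N))} {r r' t t' ε R : ℝ}

variable (S) in
/-- `W` consists of paths of length `n` from `i` to itself which contract `I_i` at most by the
factor `r`. -/
structure IsLoopFamily (i : Fin N) (n : ℕ) (r : ℝ) (W : Finset (List (Fin N))) : Prop where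
  length_eq : ∀ l ∈ W, l.length = n
  isPath : ∀ l ∈ W, S.IsPath i l
  endpoint_eq : ∀ l ∈ W, endpoint i l = i
  le_abs_wordDeriv : ∀ l ∈ W, ∀ x ∈ S.interval i, r ≤ |S.wordDeriv i l x|

namespace IsLoopFamily

theorem singleton_nil (i : Fin N) : S.IsLoopFamily i 0 1 {[]} where
  length_eq l hl := by rw [Finset.mem_singleton.1 hl, List.length_nil]
  isPath l hl := by rw [Finset.mem_singleton.1 hl]; trivial
  endpoint_eq l hl := by rw [Finset.mem_singleton.1 hl]; rfl
  le_abs_wordDeriv l hl x _ := by rw [Finset.mem_singleton.1 hl, wordDeriv, abs_one]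

theorem mono (hW : S.IsLoopFamily i n r W) (hr : r' ≤ r) : S.IsLoopFamily i n r' W :=
  { hW with le_abs_wordDeriv := fun l hl x hx => hr.trans (hW.le_abs_wordDeriv l hl x hx) }

theorem image₂_append (hW : S.IsLoopFamily i n r W) (hW' : S.IsLoopFamily i n' r' W')
    (hr' : 0 ≤ r') :
    S.IsLoopFamily i (n + n') (r * r') (Finset.image₂ (· ++ ·) W W') := by
  refine ⟨?_, ?_, ?_, ?_⟩ <;> simp only [Finset.forall_mem_image₂] <;> intro l hl l' hl'
  · rw [List.length_append, hW.length_eq l hl, hW'.length_eq l' hl']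
  · exact isPath_append.2 ⟨hW.isPath l hl, (hW.endpoint_eq l hl).symm ▸ hW'.isPath l' hl'⟩
  · rw [endpoint_append, hW.endpoint_eq l hl, hW'.endpoint_eq l' hl']
  · intro x hx
    have hmem := wordMap_mem_interval (hW.isPath l hl) hx
    rw [wordDeriv_append, abs_mul]
    rw [hW.endpoint_eq l hl] at hmem ⊢
    exact mul_le_mul (hW.le_abs_wordDeriv l hl x hx) (hW'.le_abs_wordDeriv l' hl' _ hmem) hr'
      (abs_nonneg _)

theorem card_image₂_append (hW : S.IsLoopFamily i n r W) :
    (Finset.image₂ (· ++ ·) W W').card = W.card * W'.card :=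
  Finset.card_image₂_iff.2 fun p hp q hq heq => Prod.ext_iff.2 <| List.append_inj heq <| by
    rw [hW.length_eq _ hp.1, hW.length_eq _ hq.1]

theorem exists_pow (hW : S.IsLoopFamily i n r W) (hr : 0 ≤ r) (m : ℕ) :
    ∃ W', S.IsLoopFamily i (n * m) (r ^ m) W' ∧ W'.card = W.card ^ m := by
  induction m with
  | zero => exact ⟨{[]}, by simpa only [pow_zero, mul_zero] using singleton_nil i, by simp⟩
  | succ m ih =>
    obtain ⟨W', hW', hcard⟩ := ih
    refine ⟨Finset.image₂ (· ++ ·) W' W, ?_, ?_⟩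
    · simpa only [pow_succ, mul_add_one] using hW'.image₂_append hW hr
    · rw [hW'.card_image₂_append, hcard, pow_succ]

theorem wordMap_mem_interval (hW : S.IsLoopFamily i n r W) {l : List (Fin N)} (hl : l ∈ W) {x : ℝ}
    (hx : x ∈ S.interval i) : S.wordMap i l x ∈ S.interval i := by
  simpa only [hW.endpoint_eq l hl] using
    IteratedFunctionScheme.wordMap_mem_interval (hW.isPath l hl) hx

theorem mul_dist_le_dist_wordMap (hW : S.IsLoopFamily i n r W) {l : List (Fin N)} (hl : l ∈ W)
    {x y : ℝ} (hx : x ∈ S.interval i) (hy : y ∈ S.interval i) :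
    r * |x - y| ≤ |S.wordMap i l x - S.wordMap i l y| := by
  obtain ⟨z, hz, heq⟩ := exists_wordMap_sub_eq (hW.isPath l hl) hx hy
  rw [heq, abs_mul]
  gcongr
  exact hW.le_abs_wordDeriv l hl z hz

theorem gap_div_Q_mul_le (hW : S.IsLoopFamily i n r W) {l l' : List (Fin N)} (hl : l ∈ W)
    (hl' : l' ∈ W) (hne : l ≠ l') {x y : ℝ} (hx : x ∈ S.interval i) (hy : y ∈ S.interval i) :
    S.gap / S.Q * r ≤ |S.wordMap i l x - S.wordMap i l' y| := by
  rw [div_mul_eq_mul_div, div_le_iff₀' Q_pos]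
  refine le_trans ?_ (gap_mul_abs_wordDeriv_le
    ((hW.length_eq l hl).trans (hW.length_eq l' hl').symm) (fun heq => hne (Prod.ext_iff.1 heq).2)
    (hW.isPath l hl) (hW.isPath l' hl') hx hy)
  have := gap_pos (S := S)
  gcongr
  exact hW.le_abs_wordDeriv l hl x hx

theorem mul_le_dist_plane (hW : S.IsLoopFamily i n r W) (hr : 0 ≤ r) (hR : S.IsFiberBound τ R)
    (hε : 0 ≤ ε) (hcap : S.MinimallyCaptiveAt τ ε) {x : ℝ} (hx : x ∈ S.interval i)
    {l₁ l₁' l₂ l₂' : List (Fin N)} (hl₁ : l₁ ∈ W) (hl₁' : l₁' ∈ W) (hl₂ : l₂ ∈ W) (hl₂' : l₂' ∈ W)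
    (hne : (l₁, l₁') ≠ (l₂, l₂')) {η₁ η₂ : ℝ}
    (hη₁ : (S.wordMap i l₁' (S.wordMap i l₁ x), η₁) ∈ S.phaseTrapped τ)
    (hη₂ : (S.wordMap i l₂' (S.wordMap i l₂ x), η₂) ∈ S.phaseTrapped τ) :
    min (S.gap / S.Q) (S.κ * ε) * r ≤
      dist (!₂[S.wordMap i l₁ x, S.pull τ i l₁' (S.wordMap i l₁ x) η₁] : EuclideanSpace ℝ (Fin 2))
        !₂[S.wordMap i l₂ x, S.pull τ i l₂' (S.wordMap i l₂ x) η₂] := by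
  refine le_trans ?_ (max_abs_sub_le_dist_plane _ _ _ _)
  by_cases hl : l₁ = l₂
  · subst hl
    have hy := hW.wordMap_mem_interval hl₁ hx
    refine le_max_of_le_right (le_trans ?_ (hcap.mul_abs_wordDeriv_le hε hR
      ((hW.length_eq _ hl₁').trans (hW.length_eq _ hl₂').symm) (fun hl' => hne (Prod.ext rfl hl'))
      (hW.isPath _ hl₁') (hW.isPath _ hl₂') hy hη₁ hη₂))
    have := κ_pos (S := S)
    gcongr
    · exact min_le_right _ _
    · exact hW.le_abs_wordDeriv _ hl₁' _ hy
  · refine le_max_of_le_left (le_trans ?_ (hW.gap_div_Q_mul_le hl₁ hl₂ hl hx hx))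
    gcongr
    exact min_le_left _ _

/-- The loop `l` of the family as a self-map of `I_i`. -/
def intervalMap (hW : S.IsLoopFamily i n r W) (l : W) (x : S.interval i) : S.interval i :=
  ⟨S.wordMap i l x, hW.wordMap_mem_interval l.2 x.2⟩

theorem exists_coding (hW : S.IsLoopFamily i n r W) (hn : n ≠ 0) :
    ∃ π : (ℕ → W) → S.interval i, ∀ u, π u = hW.intervalMap (u 0) (π fun k => u (k + 1)) := by
  have hf (l : W) : LipschitzWith ⟨S.θ ^ n, pow_nonneg θ_pos.le n⟩ (hW.intervalMap l) :=
    .of_dist_le_mul fun x y => by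
      have hxy := abs_wordMap_sub_le (hW.isPath _ l.2) x.2 y.2
      rwa [hW.length_eq _ l.2] at hxy
  have : CompactSpace (S.interval i) := isCompact_iff_compactSpace.1 (isCompact_interval i)
  have : Nonempty (S.interval i) := ⟨⟨_, left_mem_interval i⟩⟩
  exact exists_forall_eq_apply_of_lipschitzWith
    (show (⟨S.θ ^ n, pow_nonneg θ_pos.le n⟩ : ℝ≥0) < 1 from pow_lt_one₀ θ_pos.le θ_lt_one hn)
    (fun (u : ℕ → W) k => u (k + 1)) fun u => hf (u 0)

theorem coding_mem_K (hW : S.IsLoopFamily i n r W) (hn : n ≠ 0) {π : (ℕ → W) → S.interval i}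
    (hπ : ∀ u, π u = hW.intervalMap (u 0) (π fun k => u (k + 1))) (u : ℕ → W) :
    (π u : ℝ) ∈ S.K := by
  have hKn (m : ℕ) (u : ℕ → W) : (π u : ℝ) ∈ S.Kn m := by
    induction m generalizing u with
    | zero => exact interval_subset_I i (π u).2
    | succ m ih =>
      have hmem := wordMap_mem_Kn (hW.isPath _ (u 0).2) (π fun k => u (k + 1)).2 (ih _)
      rw [hW.length_eq _ (u 0).2] at hmem
      rw [hπ u]
      exact Kn_antitone (Nat.add_le_add_left (Nat.one_le_iff_ne_zero.2 hn) m) hmem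
  exact mem_iInter.2 fun m => hKn m u

end IsLoopFamily

variable (S) in
/-- At some vertex whose interval meets `K` there are `r ^ (-t)` loops of the same length which
contract at most by the factor `r`, for some `r < 1`. -/
def HasLoopExponent (t : ℝ) : Prop :=
  ∃ i n r W, (S.K ∩ S.interval i).Nonempty ∧ 0 < r ∧ r < 1 ∧ S.IsLoopFamily i n r W ∧
    r ^ (-t) ≤ W.card

namespace HasLoopExponent

theorem of_le (h : S.HasLoopExponent t) (ht : t' ≤ t) : S.HasLoopExponent t' := by
  obtain ⟨i, n, r, W, hi, hr, hr1, hW, hcard⟩ := h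
  exact ⟨i, n, r, W, hi, hr, hr1, hW,
    (Real.rpow_le_rpow_of_exponent_ge hr hr1.le (neg_le_neg ht)).trans hcard⟩

theorem zero (hK : S.K.Nonempty) : S.HasLoopExponent 0 := by
  obtain ⟨x, hx⟩ := hK
  obtain ⟨i, hi⟩ := mem_iUnion.1 (K_subset_I hx)
  exact ⟨i, 0, 1 / 2, {[]}, ⟨x, hx, hi⟩, by norm_num, by norm_num,
    (IsLoopFamily.singleton_nil i).mono (by norm_num), by simp⟩

theorem exists_forall_pow (h : S.HasLoopExponent t) : ∃ i r, (S.K ∩ S.interval i).Nonempty ∧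
    0 < r ∧ r < 1 ∧ ∀ m : ℕ, ∃ n W, S.IsLoopFamily i n (r ^ m) W ∧ (r ^ m) ^ (-t) ≤ W.card := by
  obtain ⟨i, n, r, W, hi, hr, hr1, hW, hcard⟩ := h
  refine ⟨i, r, hi, hr, hr1, fun m => ?_⟩
  obtain ⟨W', hW', hcard'⟩ := hW.exists_pow hr.le m
  refine ⟨n * m, W', hW', ?_⟩
  rw [hcard', Nat.cast_pow, ← Real.rpow_pow_comm hr.le]
  gcongr

theorem packingBound_K (h : S.HasLoopExponent t) : PackingBound S.K t := by
  obtain ⟨i, r, ⟨x, hxK, hxi⟩, hr, hr1, hpow⟩ := h.exists_forall_pow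
  have hc : 0 < S.gap / S.Q := div_pos gap_pos Q_pos
  refine .of_forall_pow (ι := List (Fin N)) hc hr hr1 fun m => ?_
  obtain ⟨n, W, hW, hcard⟩ := hpow m
  exact ⟨W, fun l => S.wordMap i l x, fun l hl => (wordMap_mem_K_iff (hW.isPath l hl) hxi).2 hxK,
    fun l hl l' hl' hne => hW.gap_div_Q_mul_le hl hl' hne hxi hxi, hcard⟩

/-- Two loops `l`, `l'` determine the point of the trapped set with past `l` and future `l'`. -/
theorem packingBound_phaseTrappedPlane (h : S.HasLoopExponent t) (hrec : S.IsRecurrent)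
    (hR : S.IsFiberBound τ R) (hε : 0 < ε) (hcap : S.MinimallyCaptiveAt τ ε) :
    PackingBound (S.phaseTrappedPlane τ) (2 * t) := by
  obtain ⟨i, r, ⟨x, hxK, hxi⟩, hr, hr1, hpow⟩ := h.exists_forall_pow
  choose! ζ hζ using fun x => hrec.exists_mem_phaseTrapped (τ := τ) (x := x) hR
  let y (l : List (Fin N)) : ℝ := S.wordMap i l x
  let η (l l' : List (Fin N)) : ℝ := S.pull τ i l' (y l) (ζ (S.wordMap i l' (y l)))
  have hc : 0 < min (S.gap / S.Q) (S.κ * ε) := lt_min (div_pos gap_pos Q_pos) (mul_pos κ_pos hε)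
  refine .of_forall_pow (ι := List (Fin N) × List (Fin N)) hc hr hr1 fun m => ?_
  obtain ⟨n, W, hW, hcard⟩ := hpow m
  have hyK : ∀ l ∈ W, y l ∈ S.K := fun l hl => (wordMap_mem_K_iff (hW.isPath l hl) hxi).2 hxK
  have hζy : ∀ l ∈ W, ∀ l' ∈ W,
      (S.wordMap i l' (y l), ζ (S.wordMap i l' (y l))) ∈ S.phaseTrapped τ := fun l hl l' hl' =>
    hζ _ ((wordMap_mem_K_iff (hW.isPath l' hl') (hW.wordMap_mem_interval hl hxi)).2 (hyK l hl))
  refine ⟨W ×ˢ W, fun p => !₂[y p.1, η p.1 p.2], fun p hp => ?_, fun p hp q hq hne => ?_, ?_⟩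
  · obtain ⟨hl, hl'⟩ := Finset.mem_product.1 hp
    exact mem_image_of_mem _ (hR.pull_mem_phaseTrapped (hW.isPath _ hl')
      (hW.wordMap_mem_interval hl hxi) (hζy _ hl _ hl'))
  · obtain ⟨hp, hp'⟩ := Finset.mem_product.1 hp
    obtain ⟨hq, hq'⟩ := Finset.mem_product.1 hq
    exact hW.mul_le_dist_plane (pow_pos hr m).le hR hε.le hcap hxi hp hp' hq hq' hne
      (hζy _ hp _ hp') (hζy _ hq _ hq')
  · rw [Finset.card_product, Nat.cast_mul, show -(2 * t) = -t + -t by ring,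
      Real.rpow_add (pow_pos hr m)]
    gcongr

theorem ofReal_le_dimH (h : S.HasLoopExponent t) : ENNReal.ofReal t ≤ dimH S.K := by
  rcases le_or_gt t 0 with ht | ht
  · rw [ENNReal.ofReal_of_nonpos ht]
    exact zero_le
  obtain ⟨i, n, r, W, -, hr, hr1, hW, hcard⟩ := h
  have hn : n ≠ 0 := fun hn => by
    have hW1 : W.card ≤ 1 := Finset.card_le_one.2 fun l hl l' hl' => by
      rw [List.eq_nil_of_length_eq_zero ((hW.length_eq l hl).trans hn),
        List.eq_nil_of_length_eq_zero ((hW.length_eq l' hl').trans hn)]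
    have hrt : 1 < r ^ (-t) := Real.one_lt_rpow_of_pos_of_lt_one_of_neg hr hr1 (neg_lt_zero.2 ht)
    exact (hrt.trans_le hcard).not_ge (by exact_mod_cast hW1)
  obtain ⟨π, hπ⟩ := hW.exists_coding hn
  have hsep := le_dimH_range_of_coding_separated (mul_pos (div_pos gap_pos Q_pos) hr) hr hr1 ht
    (by rwa [Fintype.card_coe]) fun u v k hlt hk => le_dist_coding hπ hr.le
      (fun l x y => hW.mul_dist_le_dist_wordMap l.2 x.2 y.2)
      (fun l l' hne x y => hW.gap_div_Q_mul_le l.2 l'.2 (Subtype.coe_injective.ne hne) x.2 y.2)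
      hlt hk
  calc ENNReal.ofReal t ≤ dimH (range π) := hsep
    _ = dimH ((↑) '' range π : Set ℝ) := (isometry_subtype_coe.dimH_image _).symm
    _ ≤ dimH S.K := dimH_mono (by
        rintro _ ⟨_, ⟨u, rfl⟩, rfl⟩
        exact hW.coding_mem_K hn hπ u)

end HasLoopExponent

end IteratedFunctionScheme

/-! ### Counting words -/

theorem card_le_card_mul_of_card_fiber_le {α β : Type*} [DecidableEq β] {s : Finset α}
    {t : Finset β} {f : α → β} (hf : ∀ a ∈ s, f a ∈ t) {b : ℝ}
    (hb : ∀ y ∈ t, ((s.filter (f · = y)).card : ℝ) ≤ b) : (s.card : ℝ) ≤ t.card * b := by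
  rw [Finset.card_eq_sum_card_fiberwise hf, Nat.cast_sum, ← nsmul_eq_mul]
  exact Finset.sum_le_card_nsmul _ _ _ hb

namespace IteratedFunctionScheme

variable {N : ℕ} {S : IteratedFunctionScheme N} {i : Fin N} {l : List (Fin N)}
  {ρ s t t' : ℝ} {n : ℕ}

variable (S) in
/-- The size of the derivative of `wordMap i l`, measured at the left end point of `I_i`. -/
noncomputable def weight (i : Fin N) (l : List (Fin N)) : ℝ := |S.wordDeriv i l (S.a i)|

variable (S) in
/-- The paths `i :: l` of weight at least `ρ` which start at an interval that meets `K`. -/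
def heavyWords (ρ : ℝ) : Set (Fin N × List (Fin N)) :=
  {p | (S.K ∩ S.interval p.1).Nonempty ∧ S.IsPath p.1 p.2 ∧ ρ ≤ S.weight p.1 p.2}

theorem weight_nil (i : Fin N) : S.weight i [] = 1 := abs_one

theorem weight_le_pow (h : S.IsPath i l) : S.weight i l ≤ S.θ ^ l.length :=
  abs_wordDeriv_le_pow h (left_mem_interval i)

theorem heavyWords_finite (hρ : 0 < ρ) : (S.heavyWords ρ).Finite := by
  obtain ⟨n, hn⟩ := exists_pow_lt_of_lt_one hρ (θ_lt_one (S := S))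
  refine (finite_univ.prod (List.finite_length_le (Fin N) n)).subset fun p hp =>
    ⟨trivial, show p.2.length ≤ n from ?_⟩
  exact ((pow_lt_pow_iff_right_of_lt_one₀ θ_pos θ_lt_one).1
    (hn.trans_le (hp.2.2.trans (weight_le_pow hp.2.1)))).le

theorem card_loops_le (ht : ¬ S.HasLoopExponent t) (hi : (S.K ∩ S.interval i).Nonempty)
    (hρ : 0 < ρ) (hρ1 : ρ < 1) {W : Finset (List (Fin N))} (hW : ∀ l ∈ W, l.length = n ∧
      S.IsPath i l ∧ endpoint i l = i ∧ ρ ≤ S.weight i l) :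
    (W.card : ℝ) ≤ (ρ / S.Q) ^ (-t) := by
  by_contra! hlt
  refine ht ⟨i, n, ρ / S.Q, W, hi, div_pos hρ Q_pos,
    (div_le_self hρ.le one_le_Q).trans_lt hρ1, ⟨fun l hl => (hW l hl).1, fun l hl => (hW l hl).2.1,
      fun l hl => (hW l hl).2.2.1, fun l hl x hx => ?_⟩, hlt.le⟩
  rw [div_le_iff₀' Q_pos]
  exact (hW l hl).2.2.2.trans (abs_wordDeriv_le_mul (hW l hl).2.1 (left_mem_interval i) hx)

theorem IsRecurrent.exists_return_paths (hrec : S.IsRecurrent) :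
    ∃ (p : Fin N → Fin N → List (Fin N)) (α : ℝ), 0 < α ∧ α ≤ 1 ∧ ∀ i l, S.IsPath i l →
      S.IsPath i (l ++ p i (endpoint i l)) ∧ endpoint i (l ++ p i (endpoint i l)) = i ∧
        α * S.weight i l ≤ S.weight i (l ++ p i (endpoint i l)) := by
  have hex (i j : Fin N) : ∃ p, (∃ p', S.IsPath j p' ∧ endpoint j p' = i) →
      S.IsPath j p ∧ endpoint j p = i := by
    by_cases h : ∃ p', S.IsPath j p' ∧ endpoint j p' = i
    · exact h.imp fun _ hp _ => hp
    · exact ⟨[], fun h' => (h h').elim⟩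
  choose p hp using hex
  obtain ⟨m, hm⟩ := Finite.exists_le fun q : Fin N × Fin N => (p q.1 q.2).length
  have hκ := κ_pos (S := S)
  refine ⟨p, min 1 S.κ ^ m, by positivity, pow_le_one₀ (by positivity) (min_le_left _ _),
    fun i l h => ?_⟩
  obtain ⟨hpath, hend⟩ := hp i (endpoint i l) (hrec.exists_path_of_isPath h)
  refine ⟨isPath_append.2 ⟨h, hpath⟩, (endpoint_append _ _ _).trans hend, ?_⟩
  simp only [weight, wordDeriv_append, abs_mul]
  rw [mul_comm]
  gcongr
  calc min 1 S.κ ^ m ≤ min 1 S.κ ^ (p i (endpoint i l)).length :=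
        pow_le_pow_of_le_one (by positivity) (min_le_left _ _) (hm (i, endpoint i l))
    _ ≤ S.κ ^ (p i (endpoint i l)).length := by gcongr; exact min_le_right _ _
    _ ≤ _ := κ_pow_le_abs_wordDeriv hpath (wordMap_mem_interval h (left_mem_interval i))

theorem IsRecurrent.exists_card_le_of_length_eq (hrec : S.IsRecurrent)
    (ht : ¬ S.HasLoopExponent t) : ∃ C ≥ 0, ∀ ρ, 0 < ρ → ρ < 1 → ∀ n,
      ∀ W : Finset (Fin N × List (Fin N)), ↑W ⊆ S.heavyWords ρ → (∀ p ∈ W, p.2.length = n) →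
        (W.card : ℝ) ≤ C * ρ ^ (-t) := by
  obtain ⟨p, α, hα, hα1, hp⟩ := hrec.exists_return_paths
  have hQ := Q_pos (S := S)
  refine ⟨(Finset.univ : Finset (Fin N × Fin N)).card * (α / S.Q) ^ (-t), by positivity,
    fun ρ hρ hρ1 n W hW hn => ?_⟩
  rw [mul_assoc, ← Real.mul_rpow (by positivity) hρ.le, div_mul_eq_mul_div]
  refine card_le_card_mul_of_card_fiber_le (f := fun q => (q.1, endpoint q.1 q.2))
    (fun _ _ => Finset.mem_univ _) fun ⟨i, j⟩ _ => ?_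
  set V := W.filter fun q => (q.1, endpoint q.1 q.2) = (i, j) with hV
  have hmem (q) (hq : q ∈ V) : q ∈ W ∧ q.1 = i ∧ endpoint q.1 q.2 = j := by
    simpa only [hV, Finset.mem_filter, Prod.mk.injEq] using hq
  have hinj : InjOn (fun q : Fin N × List (Fin N) => q.2 ++ p i j) V := fun q hq q' hq' heq =>
    Prod.ext ((hmem q hq).2.1.trans (hmem q' hq').2.1.symm) (List.append_cancel_right heq)
  rcases V.eq_empty_or_nonempty with hV0 | ⟨q₀, hq₀⟩
  · rw [hV0, Finset.card_empty, Nat.cast_zero]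
    positivity
  rw [← Finset.card_image_of_injOn hinj]
  refine card_loops_le (i := i) (n := n + (p i j).length) ht ?_ (by positivity)
    ((mul_le_of_le_one_left hρ.le hα1).trans_lt hρ1) fun l' hl' => ?_
  · obtain ⟨hq₀W, rfl, -⟩ := hmem q₀ hq₀
    exact (hW hq₀W).1
  · obtain ⟨q, hq, rfl⟩ := Finset.mem_image.1 hl'
    obtain ⟨hqW, rfl, rfl⟩ := hmem q hq
    obtain ⟨-, hpath, hw⟩ := hW hqW
    obtain ⟨hpath', hend, hw'⟩ := hp q.1 q.2 hpath
    exact ⟨by rw [List.length_append, hn q hqW], hpath', hend, le_trans (by gcongr) hw'⟩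

theorem exists_length_add_one_le (hs : 0 < s) : ∃ C ≥ 0, ∀ ρ > 0, ∀ p ∈ S.heavyWords ρ,
    (p.2.length + 1 : ℝ) ≤ C * ρ ^ (-s) := by
  have hθ := θ_pos (S := S)
  set b := S.θ ^ (-s) with hb
  have hb1 : 1 < b := Real.one_lt_rpow_of_pos_of_lt_one_of_neg hθ θ_lt_one (neg_lt_zero.2 hs)
  have hb0 : 0 < b - 1 := sub_pos.2 hb1
  refine ⟨(b - 1)⁻¹ + 1, by positivity, fun ρ hρ p ⟨_, hpath, hw⟩ => ?_⟩
  have hbernoulli : 1 + p.2.length * (b - 1) ≤ b ^ p.2.length := by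
    simpa only [add_sub_cancel] using one_add_mul_le_pow (a := b - 1) (by linarith) p.2.length
  calc (p.2.length + 1 : ℝ) = (b - 1)⁻¹ * (p.2.length * (b - 1)) + 1 := by field_simp
    _ ≤ (b - 1)⁻¹ * b ^ p.2.length + b ^ p.2.length := by
        gcongr
        · linarith
        · exact one_le_pow₀ hb1.le
    _ = ((b - 1)⁻¹ + 1) * (S.θ ^ p.2.length) ^ (-s) := by
        rw [hb, Real.rpow_pow_comm hθ.le]
        ring
    _ ≤ ((b - 1)⁻¹ + 1) * ρ ^ (-s) := by
        gcongr ?_ * ?_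
        exact Real.rpow_le_rpow_of_nonpos hρ (hw.trans (weight_le_pow hpath)) (neg_nonpos.2 hs.le)

variable (S) in
/-- There are `O(ρ ^ (-t))` paths of weight at least `ρ`. -/
def WordBound (t : ℝ) : Prop :=
  ∃ C : ℝ, ∀ ρ, 0 < ρ → ρ < 1 → ((S.heavyWords ρ).ncard : ℝ) ≤ C * ρ ^ (-t)

theorem IsRecurrent.wordBound (hrec : S.IsRecurrent) (htt' : t < t')
    (ht : ¬ S.HasLoopExponent t) : S.WordBound t' := by
  obtain ⟨C, hC0, hC⟩ := hrec.exists_card_le_of_length_eq ht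
  obtain ⟨L, hL0, hL⟩ := S.exists_length_add_one_le (sub_pos.2 htt')
  refine ⟨L * C, fun ρ hρ hρ1 => ?_⟩
  rw [ncard_eq_toFinset_card _ (heavyWords_finite hρ)]
  set W := (heavyWords_finite hρ).toFinset
  have hlen : ∀ p ∈ W, p.2.length ∈ Finset.range ⌊L * ρ ^ (-(t' - t))⌋₊ := fun p hp => by
    refine Finset.mem_range.2 (Nat.le_floor ?_)
    exact_mod_cast hL ρ hρ p ((heavyWords_finite hρ).mem_toFinset.1 hp)
  calc (W.card : ℝ)
      ≤ (Finset.range ⌊L * ρ ^ (-(t' - t))⌋₊).card * (C * ρ ^ (-t)) :=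
        card_le_card_mul_of_card_fiber_le hlen fun n _ => hC ρ hρ hρ1 n _
          (fun p hp => (heavyWords_finite hρ).mem_toFinset.1 (Finset.mem_filter.1 hp).1)
          fun p hp => (Finset.mem_filter.1 hp).2
    _ ≤ L * ρ ^ (-(t' - t)) * (C * ρ ^ (-t)) := by
        rw [Finset.card_range]
        gcongr
        exact Nat.floor_le (by positivity)
    _ = L * C * ρ ^ (-t') := by
        rw [show -t' = -(t' - t) + -t by ring, Real.rpow_add hρ]
        ring

end IteratedFunctionScheme

/-! ### Coverings by words -/

namespace IteratedFunctionScheme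

variable {N : ℕ} {S : IteratedFunctionScheme N} {τ : ℝ → ℝ} {i j : Fin N} {l : List (Fin N)}
  {x y ξ δ t R : ℝ}

variable (S) in
/-- The weight of a path decreases at most by the factor `μ` when an edge is added. -/
noncomputable def μ : ℝ := min 1 S.κ / S.Q

theorem μ_pos : 0 < S.μ := div_pos (lt_min one_pos κ_pos) Q_pos

theorem μ_le_one : S.μ ≤ 1 := div_le_one_of_le₀ ((min_le_left _ _).trans one_le_Q) Q_pos.le

theorem μ_mul_Q_le_κ : S.μ * S.Q ≤ S.κ :=
  (div_mul_cancel₀ _ Q_pos.ne').trans_le (min_le_right _ _)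

theorem μ_le_κ : S.μ ≤ S.κ := (le_mul_of_one_le_right μ_pos.le one_le_Q).trans μ_mul_Q_le_κ

theorem μ_mul_weight_le_cons (h : S.IsPath i (j :: l)) :
    S.μ * S.weight j l ≤ S.weight i (j :: l) := by
  have hμ := μ_pos (S := S)
  have ha := left_mem_interval (S := S) i
  have hQ := abs_wordDeriv_le_mul h.2 (left_mem_interval j) (φ_mem_interval h.1 ha)
  simp only [weight, wordDeriv, abs_mul]
  calc S.μ * |S.wordDeriv j l (S.a j)| ≤ S.μ * (S.Q * |S.wordDeriv j l (S.φ i j (S.a i))|) := by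
        gcongr
    _ = S.μ * S.Q * |S.wordDeriv j l (S.φ i j (S.a i))| := (mul_assoc _ _ _).symm
    _ ≤ _ := by
        gcongr
        exact μ_mul_Q_le_κ.trans (κ_le_abs_dφ h.1 ha)

theorem μ_mul_weight_le_concat (h : S.IsPath i (l ++ [j])) :
    S.μ * S.weight i l ≤ S.weight i (l ++ [j]) := by
  rw [isPath_append] at h
  simp only [weight, wordDeriv_append, abs_mul, wordDeriv, mul_one]
  rw [mul_comm]
  gcongr
  exact μ_le_κ.trans (κ_le_abs_dφ h.2.1 (wordMap_mem_interval h.1 (left_mem_interval i)))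

theorem exists_suffix_of_weight_le (hδ : δ < 1) (h : S.IsPath i l) (hw : S.weight i l ≤ δ)
    (hy : y ∈ S.K ∩ S.interval i) : ∃ i' l', S.IsPath i' l' ∧ S.μ * δ ≤ S.weight i' l' ∧
      S.weight i' l' ≤ δ ∧ ∃ y' ∈ S.K ∩ S.interval i', S.wordMap i' l' y' = S.wordMap i l y := by
  induction l generalizing i y with
  | nil => exact absurd (weight_nil (S := S) i ▸ hw) hδ.not_ge
  | cons j l ih =>
    rcases le_or_gt (S.weight j l) δ with hj | hj
    · exact ih h.2 hj ⟨(φ_mem_K_iff h.1 hy.2).2 hy.1, φ_mem_interval h.1 hy.2⟩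
    · exact ⟨i, j :: l, h, (mul_le_mul_of_nonneg_left hj.le μ_pos.le).trans
        (μ_mul_weight_le_cons h), hw, y, hy, rfl⟩

theorem exists_prefix_of_weight_le (hδ : δ < 1) (h : S.IsPath i l) (hw : S.weight i l ≤ δ) :
    ∃ l₁ l₂, l = l₁ ++ l₂ ∧ S.μ * δ ≤ S.weight i l₁ ∧ S.weight i l₁ ≤ δ := by
  induction l using List.reverseRecOn with
  | nil => exact absurd (weight_nil (S := S) i ▸ hw) hδ.not_ge
  | append_singleton l j ih =>
    rcases le_or_gt (S.weight i l) δ with hj | hj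
    · obtain ⟨l₁, l₂, rfl, hl₁⟩ := ih (isPath_append.1 h).1 hj
      exact ⟨l₁, l₂ ++ [j], List.append_assoc _ _ _, hl₁⟩
    · exact ⟨l ++ [j], [], (List.append_nil _).symm,
        (mul_le_mul_of_nonneg_left hj.le μ_pos.le).trans (μ_mul_weight_le_concat h), hw⟩

theorem exists_heavyWord_near (hδ : 0 < δ) (hδ1 : δ < 1) (hx : x ∈ S.K) :
    ∃ i l, (i, l) ∈ S.heavyWords (S.μ * δ) ∧ x ∈ S.interval (endpoint i l) ∧
      |x - S.wordMap i l (S.a i)| ≤ S.Q * Metric.diam S.I * δ := by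
  obtain ⟨n, hn⟩ := exists_pow_lt_of_lt_one hδ (θ_lt_one (S := S))
  obtain ⟨i, l, rfl, h, y, hy, rfl⟩ := exists_word_of_mem_K hx n
  obtain ⟨i', l', h', hμ, hw, y', hy', heq⟩ :=
    exists_suffix_of_weight_le hδ1 h ((weight_le_pow h).trans hn.le) hy
  rw [← heq]
  refine ⟨i', l', ⟨⟨y', hy'⟩, h', hμ⟩, wordMap_mem_interval h' hy'.2, ?_⟩
  have hQ := Q_pos (S := S)
  have ha := left_mem_interval (S := S) i'
  rw [abs_sub_comm]
  calc |S.wordMap i' l' (S.a i') - S.wordMap i' l' y'|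
      ≤ S.Q * S.weight i' l' * |S.a i' - y'| := abs_wordMap_sub_le_mul h' ha hy'.2
    _ ≤ S.Q * δ * Metric.diam S.I := by
        gcongr
        exact Metric.dist_le_diam_of_mem isCompact_I.isBounded (interval_subset_I _ ha)
          (interval_subset_I _ hy'.2)
    _ = S.Q * Metric.diam S.I * δ := mul_right_comm _ _ _

theorem IsFiberBound.exists_heavyWord_pull_near (hR : S.IsFiberBound τ R) (hδ : 0 < δ)
    (hδ1 : δ < 1) (hp : (x, ξ) ∈ S.phaseTrapped τ) :
    ∃ i l, (i, l) ∈ S.heavyWords (S.μ * δ) ∧ x ∈ S.interval i ∧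
      |ξ - S.pull τ i l x 0| ≤ S.Q * (R + 1) * δ := by
  obtain ⟨n, hn⟩ := exists_pow_lt_of_lt_one hδ (θ_lt_one (S := S))
  obtain ⟨i, l, η, rfl, h, hx, hη, rfl⟩ := hR.exists_eq_pull_of_mem_phaseTrapped hp n
  obtain ⟨l₁, l₂, rfl, hμ, hw⟩ :=
    exists_prefix_of_weight_le hδ1 h ((weight_le_pow h).trans hn.le)
  rw [isPath_append] at h
  refine ⟨i, l₁, ⟨⟨x, (hR.mem_phaseTrapped_iff.1 hp).1, hx⟩, h.1, hμ⟩, hx, ?_⟩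
  have hQ := Q_pos (S := S)
  have hw₀ : 0 ≤ S.weight i l₁ := abs_nonneg _
  rw [pull_append, pull_sub_pull, sub_zero, abs_mul]
  calc _ ≤ S.Q * S.weight i l₁ * (R + 1) := by
        gcongr
        · exact abs_wordDeriv_le_mul h.1 hx (left_mem_interval i)
        · exact (hR.mono (le_add_of_nonneg_right zero_le_one)).abs_pull_le h.2
            (wordMap_mem_interval h.1 hx) hη
    _ ≤ S.Q * δ * (R + 1) := by
        have := hR.nonneg
        gcongr
    _ = S.Q * (R + 1) * δ := mul_right_comm _ _ _

namespace WordBound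

theorem exists_eventually_finset (h : S.WordBound t) : ∃ C : ℝ, ∀ᶠ δ : ℝ in 𝓝[>] 0,
    ∃ W : Finset (Fin N × List (Fin N)), (W.card : ℝ) ≤ C * δ ^ (-t) ∧
      S.heavyWords (S.μ * δ) ⊆ W := by
  obtain ⟨C, hC⟩ := h
  have hμ := μ_pos (S := S)
  refine ⟨C * S.μ ^ (-t), ?_⟩
  filter_upwards [Ioo_mem_nhdsGT one_pos] with δ ⟨hδ, hδ1⟩
  have hfin := heavyWords_finite (S := S) (mul_pos hμ hδ)
  refine ⟨hfin.toFinset, ?_, hfin.coe_toFinset.ge⟩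
  rw [← ncard_eq_toFinset_card _ hfin, mul_assoc, ← Real.mul_rpow hμ.le hδ.le]
  exact hC _ (mul_pos hμ hδ) (mul_lt_one_of_nonneg_of_lt_one_right μ_le_one hδ.le hδ1)

theorem coverBound_K (h : S.WordBound t) : CoverBound S.K t := by
  obtain ⟨C, hC⟩ := h.exists_eventually_finset
  have hQ := Q_pos (S := S)
  refine ⟨C, S.Q * Metric.diam S.I, by positivity, ?_⟩
  filter_upwards [hC, Ioo_mem_nhdsGT one_pos] with δ ⟨W, hcard, hW⟩ ⟨hδ, hδ1⟩
  refine ⟨W.image fun p => S.wordMap p.1 p.2 (S.a p.1),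
    (Nat.cast_le.2 Finset.card_image_le).trans hcard, fun x hx => ?_⟩
  obtain ⟨i, l, hl, -, hd⟩ := exists_heavyWord_near hδ hδ1 hx
  exact mem_iUnion₂.2 ⟨_, Finset.mem_image_of_mem _ (hW hl), hd⟩

theorem coverBound_phaseTrappedPlane (h : S.WordBound t) (hτ : ContDiffOn ℝ 2 τ S.I) :
    CoverBound (S.phaseTrappedPlane τ) (2 * t) := by
  classical
  obtain ⟨C, hC⟩ := h.exists_eventually_finset
  obtain ⟨R, hR⟩ := exists_isFiberBound hτ
  obtain ⟨Λ, hΛ, hlip⟩ := hR.exists_abs_pull_sub_pull_le hτ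
  have hQ := Q_pos (S := S)
  have hR0 := hR.nonneg
  set D := S.Q * Metric.diam S.I with hD
  refine ⟨C ^ 2, D + (S.Q * (R + 1) + Λ * D), by positivity, ?_⟩
  filter_upwards [hC, Ioo_mem_nhdsGT one_pos] with δ ⟨W, hcard, hW⟩ ⟨hδ, hδ1⟩
  let base (p : Fin N × List (Fin N)) : ℝ := S.wordMap p.1 p.2 (S.a p.1)
  refine ⟨(W ×ˢ W).image fun q => !₂[base q.1, S.pull τ q.2.1 q.2.2 (base q.1) 0], ?_, ?_⟩
  · calc _ ≤ ((W ×ˢ W).card : ℝ) := Nat.cast_le.2 Finset.card_image_le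
      _ = (W.card : ℝ) ^ 2 := by rw [Finset.card_product, Nat.cast_mul, sq]
      _ ≤ (C * δ ^ (-t)) ^ 2 := by gcongr
      _ = C ^ 2 * δ ^ (-(2 * t)) := by
          rw [mul_pow, ← Real.rpow_mul_natCast hδ.le]
          ring_nf
  · rintro _ ⟨⟨x, ξ⟩, hp, rfl⟩
    obtain ⟨k, v, hv, hxk, hξ⟩ := hR.exists_heavyWord_pull_near hδ hδ1 hp
    obtain ⟨i, u, hu, hxu, hd⟩ := exists_heavyWord_near hδ hδ1 (hR.mem_phaseTrapped_iff.1 hp).1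
    obtain rfl := eq_of_mem_interval hxk hxu
    refine mem_iUnion₂.2 ⟨_, Finset.mem_image_of_mem _
      (Finset.mk_mem_product (hW hu) (hW hv)), (dist_plane_le _ _ _ _).trans ?_⟩
    have hpull : |S.pull τ (endpoint i u) v x 0 - S.pull τ (endpoint i u) v (base (i, u)) 0| ≤
        Λ * (D * δ) := (hlip _ v hv.2.1 x hxk _
      (wordMap_mem_interval hu.2.1 (left_mem_interval i)) 0 (by rwa [abs_zero])).trans (by gcongr)
    calc _ ≤ D * δ + (S.Q * (R + 1) * δ + Λ * (D * δ)) :=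
          add_le_add hd ((abs_sub_le _ _ _).trans (add_le_add hξ hpull))
      _ = (D + (S.Q * (R + 1) + Λ * D)) * δ := by ring

end WordBound

/-! ### Dimensions -/

variable (S) in
/-- The exponential growth rate of the number of loops with respect to their contraction, which
is the dimension of `K`. -/
noncomputable def loopExponent : ℝ := sSup {t | S.HasLoopExponent t}

theorem bddAbove_hasLoopExponent : BddAbove {t | S.HasLoopExponent t} := by
  refine ⟨1, fun t h => ?_⟩
  rw [← ENNReal.ofReal_le_one]
  calc ENNReal.ofReal t ≤ dimH S.K := h.ofReal_le_dimH
    _ ≤ dimH (univ : Set ℝ) := dimH_mono (subset_univ _)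
    _ = 1 := Real.dimH_univ

theorem hasLoopExponent_of_lt_loopExponent (hK : S.K.Nonempty) (ht : t < S.loopExponent) :
    S.HasLoopExponent t := by
  obtain ⟨t', h, htt'⟩ := exists_lt_of_lt_csSup ⟨0, .zero hK⟩ ht
  exact h.of_le htt'.le

theorem loopExponent_nonneg (hK : S.K.Nonempty) : 0 ≤ S.loopExponent :=
  le_csSup bddAbove_hasLoopExponent (.zero hK)

namespace IsRecurrent

variable (hrec : S.IsRecurrent)
include hrec

theorem wordBound_of_loopExponent_lt (ht : S.loopExponent < t) : S.WordBound t := by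
  obtain ⟨t', htt', ht't⟩ := exists_between ht
  exact hrec.wordBound ht't fun h => htt'.not_ge (le_csSup bddAbove_hasLoopExponent h)

theorem dimH_K (hK : S.K.Nonempty) : dimH S.K = ENNReal.ofReal S.loopExponent := by
  refine le_antisymm ?_ ?_
  · refine ge_of_tendsto ((ENNReal.continuous_ofReal.tendsto _).mono_left nhdsWithin_le_nhds)
      (eventually_nhdsWithin_of_forall (s := Ioi S.loopExponent) fun t ht => ?_)
    exact (hrec.wordBound_of_loopExponent_lt ht).coverBound_K.dimH_le
      ((loopExponent_nonneg hK).trans (le_of_lt ht))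
  · refine le_of_tendsto ((ENNReal.continuous_ofReal.tendsto _).mono_left nhdsWithin_le_nhds)
      (eventually_nhdsWithin_of_forall (s := Iio S.loopExponent) fun t ht => ?_)
    exact (hasLoopExponent_of_lt_loopExponent hK ht).ofReal_le_dimH

theorem minkowskiDim_K (hK : S.K.Nonempty) : minkowskiDim S.K = S.loopExponent :=
  minkowskiDim_eq_of_forall_packingBound_of_forall_coverBound
    (fun _ ht => (hasLoopExponent_of_lt_loopExponent hK ht).packingBound_K)
    fun _ ht => (hrec.wordBound_of_loopExponent_lt ht).coverBound_K

theorem minkowskiDim_phaseTrappedPlane (hτ : ContDiffOn ℝ 2 τ S.I) (hcap : S.MinimallyCaptive τ)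
    (hK : S.K.Nonempty) :
    minkowskiDim (S.phaseTrappedPlane τ) = (2 * S.loopExponent : ℝ) := by
  obtain ⟨ε, hε, hcap⟩ := hcap
  obtain ⟨R, hR⟩ := exists_isFiberBound hτ
  refine minkowskiDim_eq_of_forall_packingBound_of_forall_coverBound (fun t ht => ?_) fun t ht => ?_
  · have h : S.HasLoopExponent (t / 2) := hasLoopExponent_of_lt_loopExponent hK (by linarith)
    simpa only [mul_div_cancel₀ t two_ne_zero] using
      h.packingBound_phaseTrappedPlane hrec hR hε hcap
  · have h : S.WordBound (t / 2) := hrec.wordBound_of_loopExponent_lt (by linarith)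
    simpa only [mul_div_cancel₀ t two_ne_zero] using h.coverBound_phaseTrappedPlane hτ

end IsRecurrent

end IteratedFunctionScheme

theorem mainTheorem5_general {N : ℕ} (S : IteratedFunctionScheme N) (τ : ℝ → ℝ)
    (hτ : ContDiffOn ℝ 2 τ S.I) (hcap : S.MinimallyCaptive τ) (hrec : S.IsRecurrent)
    (hK : S.K.Nonempty) :
    minkowskiDim (S.phaseTrappedPlane τ) = 2 * minkowskiDim S.K ∧
      2 * minkowskiDim S.K = 2 * ((dimH S.K : ℝ≥0∞) : EReal) := by
  rw [hrec.minkowskiDim_phaseTrappedPlane hτ hcap hK, hrec.minkowskiDim_K hK, hrec.dimH_K hK,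
    EReal.coe_ennreal_ofReal, max_eq_left (IteratedFunctionScheme.loopExponent_nonneg hK)]
  exact ⟨EReal.coe_mul _ _, rfl⟩

theorem mainTheorem5 (N : ℕ) (S : IteratedFunctionScheme N) (τ : ℝ → ℝ)
    (hτ : ContDiffOn ℝ ∞ τ S.I) (hcap : S.MinimallyCaptive τ) (hA : S.A.IsSymm)
    (hK : S.K.Nonempty) :
    minkowskiDim (S.phaseTrappedPlane τ) = 2 * minkowskiDim S.K ∧
      2 * minkowskiDim S.K = 2 * ((dimH S.K : ℝ≥0∞) : EReal) :=
  mainTheorem5_general S τ (hτ.of_le (by norm_cast))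
    hcap (IteratedFunctionScheme.isRecurrent_of_isSymm hA) hK
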